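/- Let $n\ge 0$ be an integer, let $R$ be a commutative ring (for example $\mathbb{C}$, or a ring of polynomials over $\mathbb{C}$ in the parameters), and let $\beta,\alpha_1,\alpha_2,\alpha_3,\gamma_{12},\gamma_3,\delta_1,\delta_2,\delta_3\in R$. **Diagrams.** Take a rectangle with $n$ nodes on its left side and $n$ nodes on its right side; its top and bottom sides are called boundaries. A diagram consists of finitely many pairwise non-crossing strings in the rectangle, each joining a node to another node or to a boundary, such that each node has at most one string attached (a node without a string is called empty), together with finitely many points on the boundaries, called ghosts, that are not at ends of strings. On each boundary the number of ghosts plus the number of strings attached to it is required to be even. A domain is a part of a boundary between two adjacent string ends, or between a corner and the nearest string end, or the whole boundary if no string is attached to it. Two diagrams are equal if their strings join the same nodes to each other and to the same boundaries, and the numbers of ghosts in corresponding domains agree modulo $2$. **Product.** The dilute ghost algebra $\mathrm{dGh}^2_n$ is the free $R$-module on the set of diagrams, with the bilinear product defined on diagrams $x,y$ as follows. Place $x$ to the left of $y$, identifying the $i$-th right node of $x$ with the $i$-th left node of $y$ for each $i$. If a string meets an empty node, then $xy=0$. Otherwise number the string ends and ghosts on each boundary $1,2,3,\dots$ from left to right.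 Remove every closed loop and multiply by $\beta$ for each. Remove every boundary arc, that is, every string with both ends on the boundaries, leaving a ghost at each of its two ends, and multiply by one parameter for each arc, according to its ends. For an arc with both ends on the top boundary the parameter is $\alpha_1$ if its left end has an odd and its right end an even number, $\alpha_2$ if its left end has an even and its right end an odd number, and $\alpha_3$ if the two numbers have the same parity; for an arc with both ends on the bottom boundary it is $\delta_1,\delta_2,\delta_3$ by the same rule; for an arc from the top to the bottom boundary it is $\gamma_{12}$ if the numbers of its two ends have different parity and $\gamma_3$ if they have the same parity. Then remove the line in the middle. **Theorem.** For all diagrams $x$ and $y$, the drawing left after concatenating $x$ and $y$ and removing every string that is not attached to one of the $2n$ outer nodes at one end and to an outer node or a boundary at the other, with a ghost left at each removed string end on a boundary, is again a diagram, so that the product is well defined; and the dilute ghost algebra is associative: $(ab)c=a(bc)$ for all $a,b,c\in\mathrm{dGh}^2_n$. -/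

import Mathlib

noncomputable section

namespace DiluteGhost

/-- The `2n` nodes of the rectangle: `n` on the left side and `n` on the right side, each numbered
from the top to the bottom. -/
inductive Node (n : ℕ) : Type
  | left (i : Fin n)
  | right (i : Fin n)

/-- The two boundaries: the top side and the bottom side of the rectangle. -/
inductive Side : Type
  | top
  | bottom

/-- The combinatorial data of a drawing in the two-boundary rectangle with `2n` nodes.
* `strings` is the graph of the strings joining a node to another node.
* `word s` lists what sits on the boundary `s`, from left to right: `none` is a ghost and `some v` is
  the endpoint of a string that joins the node `v` to the boundary `s`. -/
@[ext]
structure Drawing (n : ℕ) : Type where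
  strings : SimpleGraph (Node n)
  word : Side → List (Option (Node n))

namespace Drawing

variable {n : ℕ}

/-- The string endpoints around the rectangle, clockwise from the bottom left corner; each endpoint
on a boundary is recorded as the node at the other end of its string. -/
def perimeter (d : Drawing n) : List (Node n) :=
  (List.finRange n).reverse.map Node.left ++ (d.word Side.top).reduceOption ++
    (List.finRange n).map Node.right ++ (d.word Side.bottom).reverse.reduceOption

/-- `u` and `v` are the same node, or are joined by a string. -/
def SameString (d : Drawing n) (u v : Node n) : Prop :=
  u = v ∨ d.strings.Adj u v

/-- The node `v` has a string attached to it, that is, it is not empty. -/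
def Occupied (d : Drawing n) (v : Node n) : Prop :=
  (∃ w, d.strings.Adj v w) ∨ ∃ s, some v ∈ d.word s

/-- The conditions for a drawing to be a diagram, drawn with at most one ghost in each domain. -/
structure IsDiagram (d : Drawing n) : Prop where
  /-- A node is joined to at most one other node. -/
  adj_unique : ∀ u v w, d.strings.Adj u v → d.strings.Adj u w → v = w
  /-- A node has at most one string to the boundaries. -/
  nodup : (d.word Side.top ++ d.word Side.bottom).reduceOption.Nodup
  /-- A node joined to a boundary is not joined to another node. -/
  not_adj : ∀ s v w, some v ∈ d.word s → ¬ d.strings.Adj v w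
  /-- There is at most one ghost between adjacent string endpoints or corners. -/
  reduced : ∀ s, (d.word s).IsChain fun a b => ¬ (a = none ∧ b = none)
  /-- The number of ghosts plus the number of strings on each boundary is even. -/
  even : ∀ s, Even (d.word s).length
  /-- Strings do not cross. -/
  noncrossing : ∀ a b a' b', List.Sublist [a, b, a', b'] d.perimeter →
    d.SameString a a' → d.SameString b b' → d.SameString a b

end Drawing

/-- The basis diagrams. Every diagram has exactly one drawing with at most one ghost in each domain,
and diagrams are equal exactly when these drawings are. -/
@[ext]
structure Diagram (n : ℕ) : Type extends Drawing n where
  isDiagram : toDrawing.IsDiagram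

/-- The `3n` nodes of two rectangles placed side by side, with the right nodes of the first
identified with the left nodes of the second. -/
inductive Vertex (n : ℕ) : Type
  | left (i : Fin n)
  | middle (i : Fin n)
  | right (i : Fin n)

namespace Vertex

variable {n : ℕ}

/-- The nodes of the first (left) rectangle. -/
def ofFirst : Node n ↪ Vertex n where
  toFun
    | Node.left i => left i
    | Node.right i => middle i
  inj' := by rintro (i | i) (j | j) h <;> simp_all

/-- The nodes of the second (right) rectangle. -/
def ofSecond : Node n ↪ Vertex n where
  toFun
    | Node.left i => middle i
    | Node.right i => right i
  inj' := by rintro (i | i) (j | j) h <;> simp_all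

/-- The nodes of the concatenated rectangle. -/
def outer : Node n → Vertex n
  | Node.left i => left i
  | Node.right i => right i

end Vertex

/-- Removes pairs of adjacent ghosts. -/
def removePairs {α : Type} : List (Option α) → List (Option α)
  | [] => []
  | some a :: l => some a :: removePairs l
  | none :: l =>
    match removePairs l with
    | none :: l' => l'
    | l' => none :: l'

/-! ### Concatenation -/

variable {n : ℕ}

/-- The graph formed by the strings joining two nodes in the concatenation of `x` and `y`. -/
def glue (x y : Drawing n) : SimpleGraph (Vertex n) :=
  x.strings.map Vertex.ofFirst ⊔ y.strings.map Vertex.ofSecond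

/-- The ghosts and string endpoints on the boundary `s` of the concatenation, from left to right. -/
def glueWord (x y : Drawing n) (s : Side) : List (Option (Vertex n)) :=
  (x.word s).map (Option.map Vertex.ofFirst) ++ (y.word s).map (Option.map Vertex.ofSecond)

/-- No string meets an empty node in the concatenation. -/
def Compatible (x y : Drawing n) : Prop :=
  ∀ i, x.Occupied (Node.right i) ↔ y.Occupied (Node.left i)

/-- The closed loops of the concatenation: the connected components in which every vertex is a middle
node with strings to other middle nodes on both of its sides. -/
def loops (x y : Drawing n) : Set (glue x y).ConnectedComponent :=
  {C | ∀ p ∈ C.supp, ∃ i, p = Vertex.middle i ∧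
    (∃ v, x.strings.Adj (Node.right i) v) ∧ (∃ v, y.strings.Adj (Node.left i) v)}

/-- The entries at position `k` of the boundary `s` and at position `l` of the boundary `t` (positions
counted from `0`) are endpoints of the same string of the concatenation. -/
def Joined (x y : Drawing n) (s : Side) (k : ℕ) (t : Side) (l : ℕ) : Prop :=
  ∃ p q, (glueWord x y s)[k]? = some (some p) ∧ (glueWord x y t)[l]? = some (some q) ∧
    (glue x y).Reachable p q

open scoped Classical in
/-- What is left of a boundary entry of the concatenation once the strings that are not attached to
a node of the large rectangle are removed: a ghost stays a ghost, the endpoint of a string is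
relabelled by the outer node at the other end if there is one, and becomes a ghost otherwise. -/
def relabel (x y : Drawing n) : Option (Vertex n) → Option (Node n)
  | none => none
  | some p =>
    if h : ∃ v, (glue x y).Reachable (Vertex.outer v) p then some h.choose else none

/-- The drawing left after concatenation, when the loops and boundary arcs have been removed, with a
ghost left at each endpoint of a boundary arc, and pairs of ghosts in the same domain cancelled. -/
def concat (x y : Drawing n) : Drawing n where
  strings :=
    { Adj := fun v w => v ≠ w ∧ (glue x y).Reachable (Vertex.outer v) (Vertex.outer w)
      symm := ⟨fun _ _ h => ⟨h.1.symm, h.2.symm⟩⟩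
      loopless := ⟨fun _ h => h.1 rfl⟩ }
  word s := removePairs ((glueWord x y s).map (relabel x y))

/-! ### Parameters -/

/-- The nine parameters, with values in `R`. -/
structure Params (R : Type*) where
  (β α₁ α₂ α₃ γ₁₂ γ₃ δ₁ δ₂ δ₃ : R)

section Weights

variable {R : Type*} [CommRing R] (P : Params R)

open scoped Classical in
/-- The parameter of an arc with both ends on one boundary, at positions `k` (left end) and `l` (right
end), counted from `1`. -/
def Params.sameSide : Side → ℕ → ℕ → R
  | Side.top, k, l =>
    if Odd k ∧ Even l then P.α₁ else if Even k ∧ Odd l then P.α₂ else P.α₃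
  | Side.bottom, k, l =>
    if Odd k ∧ Even l then P.δ₁ else if Even k ∧ Odd l then P.δ₂ else P.δ₃

open scoped Classical in
/-- The parameter of an arc from position `k` on the top boundary to position `l` on the bottom
boundary, counted from `1`. -/
def Params.topBottom (k l : ℕ) : R :=
  if (Even k ↔ Even l) then P.γ₃ else P.γ₁₂

open scoped Classical in
/-- The product of the parameters of the arcs with both ends on the boundary `s`. -/
def sameSideWeight (x y : Drawing n) (s : Side) : R :=
  ∏ l ∈ Finset.range (glueWord x y s).length, ∏ k ∈ Finset.range l,
    if Joined x y s k s l then P.sameSide s (k + 1) (l + 1) else 1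

open scoped Classical in
/-- The product of the parameters of the arcs from the top to the bottom boundary. -/
def topBottomWeight (x y : Drawing n) : R :=
  ∏ k ∈ Finset.range (glueWord x y Side.top).length,
    ∏ l ∈ Finset.range (glueWord x y Side.bottom).length,
      if Joined x y Side.top k Side.bottom l then P.topBottom (k + 1) (l + 1) else 1

/-- The product of the parameters of all loops and boundary arcs of the concatenation. -/
def weight (x y : Drawing n) : R :=
  P.β ^ (loops x y).ncard * sameSideWeight P x y Side.top * sameSideWeight P x y Side.bottom *
    topBottomWeight P x y

end Weights

/-! ### The algebra -/

/-- The dilute ghost algebra: the free module on the diagrams, with the product below. -/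
@[nolint unusedArguments]
def DGh {R : Type*} [CommRing R] (_P : Params R) (n : ℕ) : Type _ := Diagram n →₀ R

section Product

variable {R : Type*} [CommRing R] (P : Params R)

instance : AddCommGroup (DGh P n) := inferInstanceAs (AddCommGroup (Diagram n →₀ R))

instance : Module R (DGh P n) := inferInstanceAs (Module R (Diagram n →₀ R))

/-- The basis of diagrams. -/
def DGh.basis : Module.Basis (Diagram n) R (DGh P n) :=
  Module.Basis.ofRepr (LinearEquiv.refl R (Diagram n →₀ R))

open scoped Classical in
/-- The product of two diagrams: zero if a string meets an empty node, and otherwise the diagram left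
after concatenation, times the parameters of the removed loops and boundary arcs. (The second case
distinction only makes the definition total: `concat` of two diagrams always is a diagram.) -/
def mulDiagram (x y : Diagram n) : DGh P n :=
  if Compatible x.toDrawing y.toDrawing then
    if h : (concat x.toDrawing y.toDrawing).IsDiagram then
      weight P x.toDrawing y.toDrawing • DGh.basis P ⟨concat x.toDrawing y.toDrawing, h⟩
    else 0
  else 0

/-- The bilinear extension of the product of diagrams. -/
def mulBilin : DGh P n →ₗ[R] DGh P n →ₗ[R] DGh P n :=
  (DGh.basis P).constr R fun x => (DGh.basis P).constr R fun y => mulDiagram P x y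

/-- The dilute ghost algebra as a ring, where associativity is not yet known. -/
instance : NonUnitalNonAssocRing (DGh P n) where
  mul a b := mulBilin P a b
  left_distrib a b c := map_add (mulBilin P a) b c
  right_distrib a b c := LinearMap.map_add₂ (mulBilin P) a b c
  zero_mul a := LinearMap.map_zero₂ (mulBilin P) a
  mul_zero a := map_zero (mulBilin P a)

instance : IsScalarTower R (DGh P n) (DGh P n) where
  smul_assoc r a b := LinearMap.map_smul₂ (mulBilin P) r a b

instance : SMulCommClass R (DGh P n) (DGh P n) where
  smul_comm r a b := ((mulBilin P a).map_smul r b).symm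

end Product

end DiluteGhost

end

noncomputable section

namespace DiluteGhost

/-! The drawing left after concatenation is determined by reachability in the graph `glue x y` of
strings on the `3n` nodes. That it is again a diagram rests on two facts. First, each vertex has two
slots for string pieces, boundary ends and the status of an outer node, and a connected component
with `m` vertices has at least `m - 1` edges; hence a string has at most two ends
(`countP_glueEnds_add_card_outer_le`), which gives uniqueness of partners. Secondly, planarity
depends only on the cyclic order around the rectangle: the two perimeters are placed so that the
common sides face each other and are sewn together pair by pair, and identifying two adjacent
entries never creates a crossing (`NonCrossing.sew`).

For associativity, both bracketings are compared with the graph `tripleGlue x y z` on `4n` nodes.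
The structure `Nested` describes how this graph arises from an inner product and a third drawing, so
that one set of lemmas serves both sides. A string closed off in the inner product is a whole
component of the large graph; every other string survives as a string of the outer product. So each
arc (`Nested.arcWeight_eq`) and each loop (`Nested.ncard_loops_add_ncard_loops`) of the triple
concatenation is counted in exactly one of the two weights, and `Nested.weight_mul_weight` expresses
their product by data that do not depend on the bracketing.

The parameters of arcs depend on parities of positions. These are stable because a removed end
leaves a ghost in its place, ghosts cancel only in pairs, and all boundary words of diagrams have
even length, so that a word placed in front shifts positions by an even number. A word is therefore
replaced by its `marks`, the endpoints with their parities; reduced words of even length are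
determined by them (`eq_of_marks_eq`), so the boundary words of both bracketings agree as well.

The zero case needs that a product occupies the outer nodes that its factors occupy
(`occupied_concat_iff`). A string cannot start at an outer node and end nowhere: its nodes in each
of the two rectangles are paired off by strings, which contradicts a parity count. -/

section

variable {α γ : Type}

/-! ### Marks on a word -/

/-- The string endpoints of a word, each with the parity of its position (`true` for odd), where the
first position has parity `b`. -/
def marks : Bool → List (Option α) → List (Bool × α)
  | _, [] => []
  | b, none :: l => marks (!b) l
  | b, some a :: l => (b, a) :: marks (!b) l

theorem removePairs_none_cons (l : List (Option α)) :
    (∃ l', removePairs l = none :: l' ∧ removePairs (none :: l) = l') ∨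
      ((∀ l', removePairs l ≠ none :: l') ∧ removePairs (none :: l) = none :: removePairs l) := by
  rcases h : removePairs l with _ | ⟨_ | a, l'⟩
  · right; simp [removePairs, h]
  · left; simp [removePairs, h]
  · right; simp [removePairs, h]

/-- Deleting two adjacent ghosts moves all later endpoints by two places. -/
theorem marks_removePairs (b : Bool) (l : List (Option α)) :
    marks b (removePairs l) = marks b l := by
  induction l generalizing b with
  | nil => rfl
  | cons o l ih =>
    rcases o with _ | a
    · rcases removePairs_none_cons l with ⟨l', h, h'⟩ | ⟨-, h'⟩
      · rw [h', marks, ← ih, h, marks, Bool.not_not]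
      · rw [h', marks, marks, ih]
    · simp [removePairs, marks, ih]

theorem even_length_removePairs (l : List (Option α)) :
    Even (removePairs l).length ↔ Even l.length := by
  induction l with
  | nil => rfl
  | cons o l ih =>
    rcases o with _ | a
    · rcases removePairs_none_cons l with ⟨l', h, h'⟩ | ⟨-, h'⟩
      · rw [h', List.length_cons, Nat.even_add_one, ← ih, h, List.length_cons, Nat.even_add_one,
          not_not]
      · rw [h', List.length_cons, List.length_cons, Nat.even_add_one, Nat.even_add_one, ih]
    · simp [removePairs, Nat.even_add_one, ih]

theorem isChain_removePairs (l : List (Option α)) :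
    (removePairs l).IsChain fun a b => ¬ (a = none ∧ b = none) := by
  induction l with
  | nil => exact List.isChain_nil
  | cons o l ih =>
    rcases o with _ | a
    · rcases removePairs_none_cons l with ⟨l', h, h'⟩ | ⟨h, h'⟩
      · rw [h']
        rw [h] at ih
        exact ih.tail
      · rw [h', List.isChain_cons]
        refine ⟨fun y hy => ?_, ih⟩
        rcases h'' : removePairs l with _ | ⟨_ | a, l'⟩
        · simp [h''] at hy
        · exact absurd h'' (h l')
        · simp only [h'', List.head?_cons, Option.mem_some_iff] at hy
          simp [← hy]
    · simp only [removePairs, List.isChain_cons]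
      exact ⟨by simp, ih⟩

/-- With at most one ghost per domain, the parities of consecutive endpoints tell whether a ghost
lies between them; the parity of the length decides about the last domain. -/
theorem eq_of_marks_eq {b : Bool} {l l' : List (Option α)}
    (hl : l.IsChain fun a b => ¬ (a = none ∧ b = none))
    (hl' : l'.IsChain fun a b => ¬ (a = none ∧ b = none))
    (hlen : Even l.length ↔ Even l'.length) (h : marks b l = marks b l') : l = l' := by
  induction l generalizing b l' with
  | nil =>
    rcases l' with _ | ⟨_ | a, _ | ⟨_ | a', l'⟩⟩
    · rfl
    · simp at hlen
    · simp at hl'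
    · simp [marks] at h
    · simp [marks] at h
    · simp [marks] at h
    · simp [marks] at h
  | cons o l ih =>
    rcases o with _ | a
    · rcases l' with _ | ⟨_ | a', l'⟩
      · rcases l with _ | ⟨_ | a', l⟩
        · simp at hlen
        · simp at hl
        · simp [marks] at h
      · rw [ih (l' := l') hl.tail hl'.tail (by
          simpa [Nat.even_add_one, not_iff_not, -Nat.not_even_iff_odd] using hlen) h]
      · rcases l with _ | ⟨_ | a'', l⟩
        · simp [marks] at h
        · simp at hl
        · simp [marks] at h
    · rcases l' with _ | ⟨_ | a', l'⟩
      · simp [marks] at h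
      · rcases l' with _ | ⟨_ | a'', l'⟩
        · simp [marks] at h
        · simp at hl'
        · simp [marks] at h
      · simp only [marks, List.cons.injEq, Prod.mk.injEq, true_and] at h
        rw [ih (l' := l') hl.tail hl'.tail (by
          simpa [Nat.even_add_one, not_iff_not, -Nat.not_even_iff_odd] using hlen) h.2, h.1]

theorem marks_append (b : Bool) (l l' : List (Option α)) (h : Even l.length) :
    marks b (l ++ l') = marks b l ++ marks b l' := by
  -- The induction passes through prefixes of odd length, so the parity at which `l'` starts is kept
  -- general.
  have key : ∀ (l : List (Option α)) (b : Bool), marks b (l ++ l') =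
      marks b l ++ marks (if Even l.length then b else !b) l' := by
    intro l
    induction l with
    | nil => simp [marks]
    | cons o l ih =>
      intro b
      rcases o with _ | a <;> simp only [List.cons_append, marks, ih, List.length_cons,
        Nat.even_add_one] <;> by_cases h : Even l.length <;> simp [h]
  simp [key, h]

theorem marks_map (b : Bool) (l : List (Option α)) (f : Option α → Option γ)
    (hf : f none = none) :
    marks b (l.map f) = (marks b l).filterMap fun m => (f (some m.2)).map (Prod.mk m.1) := by
  induction l generalizing b with
  | nil => rfl
  | cons o l ih =>
    rcases o with _ | a
    · simp [marks, hf, ih]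
    · rcases h : f (some a) with _ | c <;> simp [marks, h, ih]

theorem marks_map_map (b : Bool) (l : List (Option α)) (f : α → γ) :
    marks b (l.map (Option.map f)) = (marks b l).map fun m => (m.1, f m.2) := by
  rw [marks_map _ _ _ rfl, ← List.filterMap_eq_map]
  rfl

theorem map_snd_marks (b : Bool) (l : List (Option α)) :
    (marks b l).map Prod.snd = l.reduceOption := by
  induction l generalizing b with
  | nil => rfl
  | cons o l ih =>
    rcases o with _ | a <;> simp [marks, ih, List.reduceOption_cons_of_none,
      List.reduceOption_cons_of_some]

/-! ### Products over pairs -/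

section PairProd

variable {R : Type*} [CommMonoid R]

/-- The product of `f a b` over all pairs of entries of a list with `a` before `b`. -/
def pairProd {β : Type*} (f : β → β → R) : List β → R
  | [] => 1
  | a :: l => (l.map (f a)).prod * pairProd f l

variable {β β' : Type*}

theorem pairProd_append (f : β → β → R) (l l' : List β) :
    pairProd f (l ++ l') =
      pairProd f l * pairProd f l' * (l.map fun a => (l'.map (f a)).prod).prod := by
  induction l with
  | nil => simp [pairProd]
  | cons a l ih =>
    simp only [List.cons_append, pairProd, ih, List.map_append, List.prod_append, List.map_cons,
      List.prod_cons]
    ac_rfl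

theorem pairProd_congr {f g : β → β → R} {l : List β} (h : l.Pairwise fun a b => f a b = g a b) :
    pairProd f l = pairProd g l := by
  induction h with
  | nil => rfl
  | cons h _ ih => rw [pairProd, pairProd, ih, List.map_congr_left h]

theorem pairProd_mul (f g : β → β → R) (l : List β) :
    pairProd (fun a b => f a b * g a b) l = pairProd f l * pairProd g l := by
  induction l with
  | nil => simp [pairProd]
  | cons a l ih =>
    simp only [pairProd, ih, List.prod_map_mul]
    ac_rfl

/-- The extension of `f` by `1` to pairs where a partial function is not defined. -/
def extendOne (φ : β → Option β') (f : β' → β' → R) (a b : β) : R :=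
  match φ a, φ b with
  | some a', some b' => f a' b'
  | _, _ => 1

/-- Dropped entries are kept with factor `1`. This turns products over different selections from one
list into products over the same pairs, which can be compared factor by factor. -/
theorem pairProd_filterMap (φ : β → Option β') (f : β' → β' → R) (l : List β) :
    pairProd f (l.filterMap φ) = pairProd (extendOne φ f) l := by
  induction l with
  | nil => rfl
  | cons a l ih =>
    have key : ∀ a', φ a = some a' → ((l.filterMap φ).map (f a')).prod =
        (l.map (extendOne φ f a)).prod := by
      intro a' h
      clear ih
      induction l with
      | nil => rfl
      | cons b l ih =>
        rcases h' : φ b with _ | b'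
        · rw [List.filterMap_cons_none h', ih, List.map_cons, List.prod_cons]
          simp [extendOne, h, h']
        · rw [List.filterMap_cons_some h', List.map_cons, List.prod_cons, ih, List.map_cons,
            List.prod_cons]
          simp [extendOne, h, h']
    rcases h : φ a with _ | a'
    · rw [List.filterMap_cons_none h, ih, pairProd]
      have : extendOne φ f a = fun _ => 1 := funext fun b => by simp [extendOne, h]
      simp [this]
    · rw [List.filterMap_cons_some h, pairProd, ih, key a' h, pairProd]

theorem pairProd_map (φ : β → β') (f : β' → β' → R) (l : List β) :
    pairProd f (l.map φ) = pairProd (fun a b => f (φ a) (φ b)) l := by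
  rw [← List.filterMap_eq_map, pairProd_filterMap]
  rfl

/-! ### Products over positions of a word -/

theorem prod_range_marks (g : Bool → α → R) (b : Bool) (l : List (Option α)) :
    ∏ k ∈ Finset.range l.length,
        (match l[k]? with
          | some (some p) => g (if Even k then b else !b) p
          | _ => 1) =
      ((marks b l).map fun m => g m.1 m.2).prod := by
  induction l generalizing b with
  | nil => rfl
  | cons o l ih =>
    rw [List.length_cons, Finset.prod_range_succ']
    have e : ∀ k, (if Even (k + 1) then b else !b) = if Even k then !b else !!b := by
      intro k
      by_cases h : Even k <;> simp [h, Nat.even_add_one]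
    simp only [List.getElem?_cons_succ, e]
    rw [ih]
    rcases o with _ | a
    · simp [marks]
    · simp [marks, mul_comm]

theorem prod_range_range_marks (g : Bool → α → Bool → α → R) (b : Bool) (l : List (Option α)) :
    ∏ i ∈ Finset.range l.length, ∏ k ∈ Finset.range i,
        (match l[k]?, l[i]? with
          | some (some p), some (some q) =>
            g (if Even k then b else !b) p (if Even i then b else !b) q
          | _, _ => 1) =
      pairProd (fun m m' => g m.1 m.2 m'.1 m'.2) (marks b l) := by
  induction l generalizing b with
  | nil => rfl
  | cons o l ih =>
    rw [List.length_cons, Finset.prod_range_succ']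
    have e : ∀ k, (if Even (k + 1) then b else !b) = if Even k then !b else !!b := by
      intro k
      by_cases h : Even k <;> simp [h, Nat.even_add_one]
    simp only [List.getElem?_cons_succ, Finset.prod_range_succ', e, Finset.prod_mul_distrib]
    rw [ih]
    rcases o with _ | a
    · simp [marks]
    · simp only [List.getElem?_cons_zero, Even.zero, if_true, Finset.range_zero, Finset.prod_empty,
        mul_one, marks, pairProd]
      rw [← prod_range_marks (fun b' q => g b a b' q), mul_comm]
      congr 1
      refine Finset.prod_congr rfl fun i _ => ?_
      rcases l[i]? with _ | _ | q <;> rfl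

end PairProd

end

section

/-! ### Noncrossing relations on lists -/

section Noncrossing

variable {α γ : Type*}

/-- If `a` and `c` are related, `b` and `d` are related, and `a, b, c, d` appear in this order in the
list, then `a` and `b` are related. -/
def NonCrossing (r : α → α → Prop) (l : List α) : Prop :=
  ∀ a b c d, List.Sublist [a, b, c, d] l → r a c → r b d → r a b

theorem NonCrossing.mono {r : α → α → Prop} {l l' : List α} (h : NonCrossing r l)
    (hl : l'.Sublist l) : NonCrossing r l' :=
  fun a b c d h' => h a b c d (h'.trans hl)

theorem exists_sublist_of_sublist_filterMap (φ : α → Option γ) (l : List α) (m : List γ)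
    (h : m.Sublist (l.filterMap φ)) : ∃ l' : List α, l'.Sublist l ∧ l'.map φ = m.map some := by
  induction l generalizing m with
  | nil => exact ⟨[], by simp_all⟩
  | cons a l ih =>
    rcases ha : φ a with _ | c
    · rw [List.filterMap_cons_none ha] at h
      obtain ⟨l', h1, h2⟩ := ih m h
      exact ⟨l', h1.cons a, h2⟩
    · rw [List.filterMap_cons_some ha] at h
      cases h with
      | cons _ h =>
        obtain ⟨l', h1, h2⟩ := ih m h
        exact ⟨l', h1.cons a, h2⟩
      | cons_cons _ h =>
        obtain ⟨l', h1, h2⟩ := ih _ h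
        exact ⟨a :: l', h1.cons_cons a, by simp [ha, h2]⟩

theorem NonCrossing.filterMap {r : α → α → Prop} {s : γ → γ → Prop} {φ : α → Option γ} {l : List α}
    (h : NonCrossing r l)
    (hφ : ∀ a b c d, φ a = some c → φ b = some d → (r a b ↔ s c d)) :
    NonCrossing s (l.filterMap φ) := by
  intro a b c d h' hac hbd
  obtain ⟨l', h1, h2⟩ := exists_sublist_of_sublist_filterMap φ l _ h'
  obtain _ | ⟨a', _ | ⟨b', _ | ⟨c', _ | ⟨d', _ | ⟨e', l'⟩⟩⟩⟩⟩ := l' <;>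
    simp only [List.map_cons, List.map_nil, List.cons.injEq, reduceCtorEq, and_false,
      and_true] at h2
  obtain ⟨ha, hb, hc, hd⟩ := h2
  exact (hφ _ _ _ _ ha hb).1
    (h a' b' c' d' h1 ((hφ _ _ _ _ ha hc).2 hac) ((hφ _ _ _ _ hb hd).2 hbd))

theorem NonCrossing.map {r : α → α → Prop} {s : γ → γ → Prop} {f : α → γ} {l : List α}
    (h : NonCrossing r l) (hf : ∀ a b, r a b ↔ s (f a) (f b)) : NonCrossing s (l.map f) := by
  rw [← List.filterMap_eq_map]
  refine h.filterMap fun a b c d hc hd => ?_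
  simp only [Function.comp_apply, Option.some.injEq] at hc hd
  rw [← hc, ← hd, hf]

/-- For an equivalence relation the condition depends only on the cyclic order: a quadruple `a, b,
c, x` is read as `x, a, b, c`, and transitivity through `x` relates `a` and `b`. -/
theorem NonCrossing.append_singleton {r : α → α → Prop} (hr : Equivalence r) {l : List α} {x : α}
    (h : NonCrossing r (x :: l)) : NonCrossing r (l ++ [x]) := by
  intro a b c d h' hac hbd
  obtain ⟨l1, l2, h12, h1, h2⟩ := List.sublist_append_iff.1 h'
  obtain rfl | rfl : l2 = [] ∨ l2 = [x] := by
    simpa [List.sublist_singleton] using h2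
  · rw [List.append_nil] at h12
    exact h a b c d ((h12 ▸ h1).cons x) hac hbd
  · obtain ⟨rfl, h3⟩ : l1 = [a, b, c] ∧ [x] = [d] := by
      refine List.append_inj' ?_ rfl
      simpa using h12.symm
    simp only [List.cons.injEq, and_true] at h3
    subst h3
    exact hr.trans (hr.symm (h x a b c (h1.cons_cons x) (hr.symm hbd) hac)) (hr.symm hbd)

theorem NonCrossing.rotate {r : α → α → Prop} (hr : Equivalence r) {l l' : List α}
    (h : NonCrossing r (l ++ l')) : NonCrossing r (l' ++ l) := by
  induction l generalizing l' with
  | nil => simpa using h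
  | cons x l ih =>
    have := ih (l' := l' ++ [x]) (by simpa using NonCrossing.append_singleton hr h)
    simpa using this

theorem NonCrossing.append {r : α → α → Prop} {l l' : List α}
    (h : NonCrossing r l) (h' : NonCrossing r l') (hd : ∀ a ∈ l, ∀ b ∈ l', ¬ r a b) :
    NonCrossing r (l ++ l') := by
  intro a b c d hs hac hbd
  obtain ⟨l1, l2, h12, h1, h2⟩ := List.sublist_append_iff.1 hs
  have hd' : ∀ a ∈ l1, ∀ b ∈ l2, ¬ r a b := fun a ha b hb => hd a (h1.subset ha) b (h2.subset hb)
  obtain _ | ⟨x1, _ | ⟨x2, _ | ⟨x3, _ | ⟨x4, _ | ⟨x5, l1⟩⟩⟩⟩⟩ := l1 <;>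
    simp only [List.cons_append, List.nil_append, List.cons.injEq, reduceCtorEq, and_false] at h12
  · exact h' a b c d (h12 ▸ h2) hac hbd
  · obtain ⟨rfl, rfl⟩ := h12
    exact absurd hac (hd' _ (by simp) _ (by simp))
  · obtain ⟨rfl, rfl, rfl⟩ := h12
    exact absurd hac (hd' _ (by simp) _ (by simp))
  · obtain ⟨rfl, rfl, rfl, rfl⟩ := h12
    exact absurd hbd (hd' _ (by simp) _ (by simp))
  · obtain ⟨rfl, rfl, rfl, rfl, rfl⟩ := h12
    exact h a b c d h1 hac hbd

/-- The relation obtained by merging the classes of `p` and `q`. -/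
def mergeClasses (r : α → α → Prop) (p q a b : α) : Prop :=
  r a b ∨ (r a p ∧ r q b) ∨ (r a q ∧ r p b)

theorem equivalence_mergeClasses {r : α → α → Prop} (hr : Equivalence r) (p q : α) :
    Equivalence (mergeClasses r p q) where
  refl a := Or.inl (hr.refl a)
  symm {a b} h := by
    rcases h with h | ⟨h, h'⟩ | ⟨h, h'⟩
    · exact Or.inl (hr.symm h)
    · exact Or.inr (Or.inr ⟨hr.symm h', hr.symm h⟩)
    · exact Or.inr (Or.inl ⟨hr.symm h', hr.symm h⟩)
  trans {a b c} h h' := by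
    have hs := @hr.symm
    have ht := @hr.trans
    unfold mergeClasses at *
    rcases h with h | ⟨h1, h2⟩ | ⟨h1, h2⟩
    · rcases h' with h' | ⟨h3, h4⟩ | ⟨h3, h4⟩
      · exact Or.inl (ht h h')
      · exact Or.inr (Or.inl ⟨ht h h3, h4⟩)
      · exact Or.inr (Or.inr ⟨ht h h3, h4⟩)
    · rcases h' with h' | ⟨h3, h4⟩ | ⟨h3, h4⟩
      · exact Or.inr (Or.inl ⟨h1, ht h2 h'⟩)
      · exact Or.inr (Or.inl ⟨h1, h4⟩)
      · exact Or.inl (ht h1 h4)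
    · rcases h' with h' | ⟨h3, h4⟩ | ⟨h3, h4⟩
      · exact Or.inr (Or.inr ⟨h1, ht h2 h'⟩)
      · exact Or.inl (ht h1 h4)
      · exact Or.inr (Or.inr ⟨h1, h4⟩)

/-- Merging the classes of two adjacent entries creates no crossings. -/
theorem NonCrossing.merge {r : α → α → Prop} (hr : Equivalence r) {l : List α} {p q : α}
    (h : NonCrossing r (p :: q :: l)) : NonCrossing (mergeClasses r p q) l := by
  intro a b c d hl hac hbd
  -- Since `p` and `q` precede all of `l`, each can serve as the first of four points.
  have hp : ∀ a b c, [a, b, c].Sublist l → r p b → r a c → r p a :=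
    fun a b c h' => h p a b c ((h'.cons q).cons_cons p)
  have hq : ∀ a b c, [a, b, c].Sublist l → r q b → r a c → r q a :=
    fun a b c h' => h q a b c ((h'.cons_cons q).cons p)
  have h1 : [a, b, c].Sublist l := List.Sublist.trans (by simp) hl
  have h2 : [b, c, d].Sublist l := List.Sublist.trans (by simp) hl
  have hs := @hr.symm
  have ht := @hr.trans
  rcases hac with hac | ⟨h3, h4⟩ | ⟨h3, h4⟩
  · rcases hbd with hbd | ⟨h5, h6⟩ | ⟨h5, h6⟩
    · exact Or.inl (h a b c d ((hl.cons q).cons p) hac hbd)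
    · exact Or.inl (ht (hs (hp a b c h1 (hs h5) hac)) (hs h5))
    · exact Or.inl (ht (hs (hq a b c h1 (hs h5) hac)) (hs h5))
  · rcases hbd with hbd | ⟨h5, h6⟩ | ⟨h5, h6⟩
    · exact Or.inr (Or.inl ⟨h3, hq b c d h2 h4 hbd⟩)
    · exact Or.inl (ht h3 (hs h5))
    · exact Or.inr (Or.inl ⟨h3, hs h5⟩)
  · rcases hbd with hbd | ⟨h5, h6⟩ | ⟨h5, h6⟩
    · exact Or.inr (Or.inr ⟨h3, hp b c d h2 h4 hbd⟩)
    · exact Or.inr (Or.inr ⟨h3, hs h5⟩)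
    · exact Or.inl (ht h3 (hs h5))

/-- Sewing together two facing runs of entries creates no crossings. -/
theorem NonCrossing.sew (ps : List (α × α)) {r : α → α → Prop} (hr : Equivalence r) {l l' : List α}
    (h : NonCrossing r (l ++ ps.map Prod.fst ++ (ps.map Prod.snd).reverse ++ l')) :
    NonCrossing (Relation.EqvGen fun a b => r a b ∨ (a, b) ∈ ps) (l ++ l') := by
  induction ps using List.reverseRecOn generalizing r with
  | nil =>
    have : (Relation.EqvGen fun a b => r a b ∨ (a, b) ∈ ([] : List (α × α))) = r := by
      simp [hr.eqvGen_eq]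
    rw [this]
    simpa using h
  | append_singleton ps m ih =>
    obtain ⟨p, q⟩ := m
    -- The last pair is the innermost one, so its two entries are adjacent; a rotation brings them
    -- to the front, where they can be merged and dropped.
    have h1 : NonCrossing r
        (p :: q :: (((ps.map Prod.snd).reverse ++ l') ++ (l ++ ps.map Prod.fst))) := by
      have := NonCrossing.rotate hr (l := l ++ ps.map Prod.fst)
        (l' := p :: q :: ((ps.map Prod.snd).reverse ++ l')) (by simpa using h)
      simpa using this
    have h2 := ih (equivalence_mergeClasses hr p q)
      (by simpa using (h1.merge hr).rotate (equivalence_mergeClasses hr p q))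
    have e : (Relation.EqvGen fun a b => mergeClasses r p q a b ∨ (a, b) ∈ ps) =
        Relation.EqvGen fun a b => r a b ∨ (a, b) ∈ ps ++ [(p, q)] := by
      ext a b
      have hpq : Relation.EqvGen (fun a b => r a b ∨ (a, b) ∈ ps ++ [(p, q)]) p q :=
        .rel _ _ (Or.inr (by simp))
      have hr' : ∀ a b, r a b → Relation.EqvGen (fun a b => r a b ∨ (a, b) ∈ ps ++ [(p, q)]) a b :=
        fun a b h => .rel _ _ (Or.inl h)
      constructor
      · intro h
        induction h with
        | rel a b h =>
          rcases h with (h | ⟨h, h'⟩ | ⟨h, h'⟩) | h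
          · exact hr' _ _ h
          · exact .trans _ _ _ (hr' _ _ h) (.trans _ _ _ hpq (hr' _ _ h'))
          · exact .trans _ _ _ (hr' _ _ h) (.trans _ _ _ (.symm _ _ hpq) (hr' _ _ h'))
          · exact .rel _ _ (Or.inr (by simp [h]))
        | refl a => exact .refl a
        | symm a b _ ih => exact .symm _ _ ih
        | trans a b c _ _ ih ih' => exact .trans _ _ _ ih ih'
      · refine Relation.EqvGen.mono ?_ _ _
        rintro a b (h | h)
        · exact Or.inl (Or.inl h)
        · rw [List.mem_append, List.mem_singleton, Prod.mk.injEq] at h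
          rcases h with h | ⟨rfl, rfl⟩
          · exact Or.inr h
          · exact Or.inl (Or.inr (Or.inl ⟨hr.refl _, hr.refl _⟩))
    rwa [e] at h2

end Noncrossing

end

/-! ### Ends of strings in a concatenation -/

section

-- A connected component with `m` vertices has at least `m - 1` edges, and its degrees sum to twice
-- the number of edges. This replaces any explicit description of strings as paths.
open scoped Classical in
theorem two_mul_card_component_le {V : Type*} [Fintype V] (G : SimpleGraph V) (w : V) :
    2 * (Finset.univ.filter (G.Reachable w)).card ≤
      ∑ p ∈ Finset.univ.filter (G.Reachable w), (G.neighborFinset p).card + 2 := by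
  have hC := (G.connectedComponentMk w).connected_toSimpleGraph
  have h1 := hC.card_vert_le_card_edgeSet_add_one
  have h2 := (G.connectedComponentMk w).toSimpleGraph.sum_degrees_eq_twice_card_edges
  set C := G.connectedComponentMk w with hC'
  set S := Finset.univ.filter (G.Reachable w)
  have hS : ∀ p, p ∈ S ↔ p ∈ C.supp := by
    intro p
    rw [SimpleGraph.ConnectedComponent.mem_supp_iff, hC', SimpleGraph.ConnectedComponent.eq]
    simpa [S] using SimpleGraph.reachable_comm
  have h3 : Nat.card C = S.card := Nat.subtype_card S hS
  have h4 : ∑ v, C.toSimpleGraph.degree v ≤ ∑ p ∈ S, (G.neighborFinset p).card := by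
    rw [Finset.sum_subtype S hS]
    refine Finset.sum_le_sum fun v _ => ?_
    rw [← SimpleGraph.card_neighborFinset_eq_degree]
    refine Finset.card_le_card_of_injOn Subtype.val (fun q hq => ?_) Subtype.val_injective.injOn
    simp only [Finset.mem_coe, SimpleGraph.mem_neighborFinset] at hq ⊢
    exact hq
  rw [h3, Nat.card_eq_fintype_card, ← SimpleGraph.edgeFinset_card] at h1
  omega

variable {n : ℕ}

def nodeEquiv (n : ℕ) : Node n ≃ Fin n ⊕ Fin n where
  toFun
    | Node.left i => Sum.inl i
    | Node.right i => Sum.inr i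
  invFun := Sum.elim Node.left Node.right
  left_inv := by rintro (i | i) <;> rfl
  right_inv := by rintro (i | i) <;> rfl

def vertexEquiv (n : ℕ) : Vertex n ≃ Fin n ⊕ Fin n ⊕ Fin n where
  toFun
    | Vertex.left i => Sum.inl i
    | Vertex.middle i => Sum.inr (Sum.inl i)
    | Vertex.right i => Sum.inr (Sum.inr i)
  invFun := Sum.elim Vertex.left (Sum.elim Vertex.middle Vertex.right)
  left_inv := by rintro (i | i | i) <;> rfl
  right_inv := by rintro (i | i | i) <;> rfl

instance : Fintype (Node n) := Fintype.ofEquiv _ (nodeEquiv n).symm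

instance : Fintype (Vertex n) := Fintype.ofEquiv _ (vertexEquiv n).symm

instance : DecidableEq (Node n) := (nodeEquiv n).decidableEq

instance : DecidableEq (Vertex n) := (vertexEquiv n).decidableEq

@[simp] theorem Vertex.ofFirst_left (i : Fin n) :
    Vertex.ofFirst (Node.left i) = Vertex.left i := rfl

@[simp] theorem Vertex.ofFirst_right (i : Fin n) :
    Vertex.ofFirst (Node.right i) = Vertex.middle i := rfl

@[simp] theorem Vertex.ofSecond_left (i : Fin n) :
    Vertex.ofSecond (Node.left i) = Vertex.middle i := rfl

@[simp] theorem Vertex.ofSecond_right (i : Fin n) :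
    Vertex.ofSecond (Node.right i) = Vertex.right i := rfl

@[simp] theorem Vertex.outer_left (i : Fin n) :
    Vertex.outer (Node.left i) = Vertex.left i := rfl

@[simp] theorem Vertex.outer_right (i : Fin n) :
    Vertex.outer (Node.right i) = Vertex.right i := rfl

theorem Vertex.outer_injective : Function.Injective (Vertex.outer (n := n)) := by
  rintro (i | i) (j | j) h <;> simp_all

/-- The nodes joined to a boundary. -/
def Drawing.ends (d : Drawing n) : List (Node n) :=
  (d.word Side.top ++ d.word Side.bottom).reduceOption

theorem Drawing.mem_ends {d : Drawing n} {v : Node n} : v ∈ d.ends ↔ ∃ s, some v ∈ d.word s := by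
  rw [ends, List.reduceOption_mem_iff, List.mem_append]
  constructor
  · rintro (h | h)
    exacts [⟨_, h⟩, ⟨_, h⟩]
  · rintro ⟨_ | _, h⟩
    exacts [Or.inl h, Or.inr h]

/-- The string endpoints on the boundaries of a concatenation. -/
def glueEnds (x y : Drawing n) : List (Vertex n) :=
  (glueWord x y Side.top ++ glueWord x y Side.bottom).reduceOption

theorem glueEnds_perm (x y : Drawing n) :
    (glueEnds x y).Perm (x.ends.map Vertex.ofFirst ++ y.ends.map Vertex.ofSecond) := by
  simp only [glueEnds, glueWord, Drawing.ends, List.reduceOption_append, List.reduceOption_map,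
    List.map_append, List.append_assoc]
  refine List.Perm.append_left _ ?_
  rw [← List.append_assoc, ← List.append_assoc]
  exact List.Perm.append_right _ List.perm_append_comm

theorem mem_glueEnds {x y : Drawing n} {p : Vertex n} :
    p ∈ glueEnds x y ↔
      (∃ v ∈ x.ends, Vertex.ofFirst v = p) ∨ ∃ v ∈ y.ends, Vertex.ofSecond v = p := by
  rw [(glueEnds_perm x y).mem_iff, List.mem_append, List.mem_map, List.mem_map]

theorem glue_adj {x y : Drawing n} {p q : Vertex n} :
    (glue x y).Adj p q ↔
      (∃ u v, x.strings.Adj u v ∧ Vertex.ofFirst u = p ∧ Vertex.ofFirst v = q) ∨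
        ∃ u v, y.strings.Adj u v ∧ Vertex.ofSecond u = p ∧ Vertex.ofSecond v = q := by
  rw [glue, SimpleGraph.sup_adj, SimpleGraph.map_adj, SimpleGraph.map_adj]

theorem glue_adj_first {x y : Drawing n} {u v : Node n} (h : x.strings.Adj u v) :
    (glue x y).Adj (Vertex.ofFirst u) (Vertex.ofFirst v) :=
  glue_adj.2 (Or.inl ⟨u, v, h, rfl, rfl⟩)

theorem glue_adj_second {x y : Drawing n} {u v : Node n} (h : y.strings.Adj u v) :
    (glue x y).Adj (Vertex.ofSecond u) (Vertex.ofSecond v) :=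
  glue_adj.2 (Or.inr ⟨u, v, h, rfl, rfl⟩)

open scoped Classical in
theorem Drawing.IsDiagram.card_neighborFinset_add_count_le {d : Drawing n} (hd : d.IsDiagram)
    (u : Node n) : (d.strings.neighborFinset u).card + d.ends.count u ≤ 1 := by
  have h1 : (d.strings.neighborFinset u).card ≤ 1 :=
    Finset.card_le_one.2 fun a ha b hb =>
      hd.adj_unique u a b (by simpa using ha) (by simpa using hb)
  have h2 : d.ends.count u ≤ 1 := List.nodup_iff_count_le_one.1 hd.nodup u
  by_cases hu : u ∈ d.ends
  · obtain ⟨s, hs⟩ := Drawing.mem_ends.1 hu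
    have : d.strings.neighborFinset u = ∅ := by
      ext v
      simpa using hd.not_adj s u v hs
    simpa [this] using h2
  · rwa [List.count_eq_zero_of_not_mem hu]

-- Every vertex has two slots: a middle vertex is a node of both rectangles, while any other vertex
-- is a node of one rectangle and is an outer node. Each slot is used at most once, because a node
-- of a diagram carries at most one string.
open scoped Classical in
theorem card_neighborFinset_glue_add_le {x y : Drawing n} (hx : x.IsDiagram) (hy : y.IsDiagram)
    (p : Vertex n) :
    ((glue x y).neighborFinset p).card + (glueEnds x y).count p +
      (Finset.univ.filter fun v => Vertex.outer v = p).card ≤ 2 := by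
  have hN : ((glue x y).neighborFinset p).card ≤
      ∑ u : Node n, ((if Vertex.ofFirst u = p then (x.strings.neighborFinset u).card else 0) +
        if Vertex.ofSecond u = p then (y.strings.neighborFinset u).card else 0) := by
    have : (glue x y).neighborFinset p =
        ((Finset.univ.filter fun u => Vertex.ofFirst u = p).biUnion fun u =>
          (x.strings.neighborFinset u).map Vertex.ofFirst) ∪
        ((Finset.univ.filter fun u => Vertex.ofSecond u = p).biUnion fun u =>
          (y.strings.neighborFinset u).map Vertex.ofSecond) := by
      ext q
      simp only [SimpleGraph.mem_neighborFinset, glue_adj, Finset.mem_union, Finset.mem_biUnion,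
        Finset.mem_filter, Finset.mem_univ, true_and, Finset.mem_map]
      grind
    rw [this, Finset.sum_add_distrib, ← Finset.sum_filter, ← Finset.sum_filter]
    refine (Finset.card_union_le _ _).trans (Nat.add_le_add ?_ ?_) <;>
    · refine Finset.card_biUnion_le.trans (le_of_eq ?_)
      simp
  have hE : (glueEnds x y).count p =
      ∑ u : Node n, ((if Vertex.ofFirst u = p then x.ends.count u else 0) +
        if Vertex.ofSecond u = p then y.ends.count u else 0) := by
    have key : ∀ (f : Node n ↪ Vertex n) (l : List (Node n)),
        (l.map f).count p = ∑ u : Node n, if f u = p then l.count u else 0 := by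
      intro f l
      by_cases h : ∃ v, f v = p
      · obtain ⟨v, rfl⟩ := h
        simp [List.count_map_of_injective _ _ f.injective]
      · rw [List.count_eq_zero_of_not_mem (by simp; grind)]
        refine (Finset.sum_eq_zero fun u _ => ?_).symm
        rw [if_neg fun h' => h ⟨u, h'⟩]
    rw [(glueEnds_perm x y).count_eq, List.count_append, key, key, Finset.sum_add_distrib]
  rw [hE]
  -- The two slots of `p`.
  have hO : (Finset.univ.filter fun v : Node n => Vertex.outer v = p).card +
      ∑ u : Node n, ((if Vertex.ofFirst u = p then 1 else 0) +
        if Vertex.ofSecond u = p then 1 else 0) = 2 := by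
    rw [Finset.sum_add_distrib, ← Finset.card_filter, ← Finset.card_filter]
    rcases p with i | i | i
    · have e1 : (Finset.univ.filter fun v : Node n => Vertex.outer v = Vertex.left i) =
        {Node.left i} := by ext (j | j) <;> simp
      have e2 : (Finset.univ.filter fun v : Node n => Vertex.ofFirst v = Vertex.left i) =
        {Node.left i} := by ext (j | j) <;> simp
      have e3 : (Finset.univ.filter fun v : Node n => Vertex.ofSecond v = Vertex.left i) =
        ∅ := by ext (j | j) <;> simp
      simp [e1, e2, e3]
    · have e1 : (Finset.univ.filter fun v : Node n => Vertex.outer v = Vertex.middle i) =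
        ∅ := by ext (j | j) <;> simp
      have e2 : (Finset.univ.filter fun v : Node n => Vertex.ofFirst v = Vertex.middle i) =
        {Node.right i} := by ext (j | j) <;> simp
      have e3 : (Finset.univ.filter fun v : Node n => Vertex.ofSecond v = Vertex.middle i) =
        {Node.left i} := by ext (j | j) <;> simp
      simp [e1, e2, e3]
    · have e1 : (Finset.univ.filter fun v : Node n => Vertex.outer v = Vertex.right i) =
        {Node.right i} := by ext (j | j) <;> simp
      have e2 : (Finset.univ.filter fun v : Node n => Vertex.ofFirst v = Vertex.right i) =
        ∅ := by ext (j | j) <;> simp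
      have e3 : (Finset.univ.filter fun v : Node n => Vertex.ofSecond v = Vertex.right i) =
        {Node.right i} := by ext (j | j) <;> simp
      simp [e1, e2, e3]
  rw [← hO, add_comm _ (Finset.card _), add_le_add_iff_left]
  refine (Nat.add_le_add_right hN _).trans ?_
  rw [← Finset.sum_add_distrib]
  refine Finset.sum_le_sum fun u _ => ?_
  have h1 := hx.card_neighborFinset_add_count_le u
  have h2 := hy.card_neighborFinset_add_count_le u
  split_ifs <;> omega

open scoped Classical in
/-- A string of a concatenation has at most two ends. -/
theorem countP_glueEnds_add_card_outer_le {x y : Drawing n} (hx : x.IsDiagram) (hy : y.IsDiagram)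
    (w : Vertex n) :
    (glueEnds x y).countP (fun p => (glue x y).Reachable w p) +
      (Finset.univ.filter fun v => (glue x y).Reachable w (Vertex.outer v)).card ≤ 2 := by
  have h := two_mul_card_component_le (glue x y) w
  set S := Finset.univ.filter ((glue x y).Reachable w) with hS
  have h1 : (glueEnds x y).countP (fun p => (glue x y).Reachable w p) =
      ∑ p ∈ S, (glueEnds x y).count p := by
    induction glueEnds x y with
    | nil => simp
    | cons a l ih =>
      simp [List.countP_cons, List.count_cons, Finset.sum_add_distrib, ih, hS]
  have h2 : (Finset.univ.filter fun v => (glue x y).Reachable w (Vertex.outer v)).card =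
      ∑ p ∈ S, (Finset.univ.filter fun v => Vertex.outer v = p).card := by
    rw [Finset.card_eq_sum_card_fiberwise (f := Vertex.outer) (t := S) (by intro v; simp [hS])]
    refine Finset.sum_congr rfl fun p hp => congrArg _ ?_
    ext v
    simp only [Finset.mem_filter, Finset.mem_univ, true_and, and_iff_right_iff_imp]
    rintro rfl
    simpa [hS] using hp
  -- Summing the slot bound over the component gives degrees plus ends at most `2 * S.card`, while
  -- the edge count bounds `2 * S.card` by the degrees plus `2`.
  have h3 := Finset.sum_le_sum fun p (_ : p ∈ S) => card_neighborFinset_glue_add_le hx hy p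
  rw [Finset.sum_add_distrib, Finset.sum_add_distrib, ← h1, ← h2] at h3
  replace h : 2 * S.card ≤ ∑ p ∈ S, ((glue x y).neighborFinset p).card + 2 := by
    convert h
  simp only [Finset.sum_const, smul_eq_mul] at h3
  omega

end

/-! ### The concatenation of two diagrams is a diagram -/

section

variable {n : ℕ} {x y : Drawing n}

theorem reachable_of_relabel_eq_some {p : Vertex n} {v : Node n}
    (h : relabel x y (some p) = some v) : (glue x y).Reachable (Vertex.outer v) p := by
  simp only [relabel] at h
  split_ifs at h with h'
  rw [← Option.some.inj h]
  exact h'.choose_spec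

theorem relabel_eq_none_iff {p : Vertex n} :
    relabel x y (some p) = none ↔ ∀ v, ¬ (glue x y).Reachable (Vertex.outer v) p := by
  simp only [relabel]
  split_ifs with h
  · simpa using h
  · simpa using h

theorem exists_relabel_eq_some {p : Vertex n} {v : Node n}
    (h : (glue x y).Reachable (Vertex.outer v) p) : ∃ w, relabel x y (some p) = some w := by
  rcases h' : relabel x y (some p) with _ | w
  · exact absurd h (relabel_eq_none_iff.1 h' v)
  · exact ⟨w, rfl⟩

/-- Two boundary ends already exhaust the two ends of a string. The condition is on pairs of list
entries because a middle node with boundary strings on both sides occurs twice in `glueEnds`. -/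
theorem pairwise_glueEnds (hx : x.IsDiagram) (hy : y.IsDiagram) :
    (glueEnds x y).Pairwise fun p q =>
      (glue x y).Reachable p q → ∀ v, ¬ (glue x y).Reachable (Vertex.outer v) p := by
  classical
  rw [List.pairwise_iff_forall_sublist]
  intro p q hs hpq v hv
  have h := countP_glueEnds_add_card_outer_le hx hy p
  have h1 := hs.countP_le (p := fun q => (glue x y).Reachable p q)
  have h2 : ([p, q]).countP (fun q => (glue x y).Reachable p q) = 2 := by
    rw [List.countP_eq_length.2]
    · rfl
    · simpa using hpq
  have h3 : 0 < (Finset.univ.filter fun v => (glue x y).Reachable p (Vertex.outer v)).card :=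
    Finset.card_pos.2 ⟨v, by simpa using hv.symm⟩
  omega

theorem eq_of_reachable_end (hx : x.IsDiagram) (hy : y.IsDiagram) {p : Vertex n} {v w : Node n}
    (hp : p ∈ glueEnds x y) (hv : (glue x y).Reachable (Vertex.outer v) p)
    (hw : (glue x y).Reachable (Vertex.outer w) p) : v = w := by
  classical
  by_contra hne
  have h := countP_glueEnds_add_card_outer_le hx hy p
  have h1 : 0 < (glueEnds x y).countP (fun q => (glue x y).Reachable p q) :=
    List.countP_pos_iff.2 ⟨p, hp, by simp⟩
  have h3 : 1 < (Finset.univ.filter fun v => (glue x y).Reachable p (Vertex.outer v)).card :=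
    Finset.one_lt_card.2 ⟨v, by simpa using hv.symm, w, by simpa using hw.symm, hne⟩
  omega

theorem eq_of_reachable_outer (hx : x.IsDiagram) (hy : y.IsDiagram) {u v w : Node n}
    (huv : u ≠ v) (huw : u ≠ w) (hv : (glue x y).Reachable (Vertex.outer u) (Vertex.outer v))
    (hw : (glue x y).Reachable (Vertex.outer u) (Vertex.outer w)) : v = w := by
  classical
  by_contra hne
  have h := countP_glueEnds_add_card_outer_le hx hy (Vertex.outer u)
  have h3 : 2 < (Finset.univ.filter fun v =>
      (glue x y).Reachable (Vertex.outer u) (Vertex.outer v)).card :=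
    Finset.two_lt_card.2 ⟨u, by simp, v, by simpa using hv, w, by simpa using hw, huv, huw, hne⟩
  omega

/-- At a boundary end the choice made in `relabel` is forced: a second outer node would be a third
end of the string. -/
theorem relabel_eq_some_iff (hx : x.IsDiagram) (hy : y.IsDiagram) {p : Vertex n}
    (hp : p ∈ glueEnds x y) {v : Node n} :
    relabel x y (some p) = some v ↔ (glue x y).Reachable (Vertex.outer v) p := by
  refine ⟨reachable_of_relabel_eq_some, fun h => ?_⟩
  obtain ⟨w, hw⟩ := exists_relabel_eq_some h
  rw [hw, eq_of_reachable_end hx hy hp h (reachable_of_relabel_eq_some hw)]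

/-- Ends of removed strings turn into ghosts instead of disappearing, so the surviving endpoints
keep their parities. -/
theorem marks_concat (b : Bool) (x y : Drawing n) (s : Side) :
    marks b ((concat x y).word s) = (marks b (glueWord x y s)).filterMap
      fun m => (relabel x y (some m.2)).map (Prod.mk m.1) := by
  rw [concat, marks_removePairs, marks_map _ _ _ rfl]

theorem reduceOption_concat (x y : Drawing n) (s : Side) :
    ((concat x y).word s).reduceOption =
      (glueWord x y s).reduceOption.filterMap fun p => relabel x y (some p) := by
  rw [← map_snd_marks true, marks_concat, ← map_snd_marks true, List.map_filterMap,
    List.filterMap_map]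
  refine congrArg (List.filterMap · _) (funext fun m => ?_)
  rcases h : relabel x y (some m.2) with _ | c <;> simp [h]

theorem ends_concat (x y : Drawing n) :
    (concat x y).ends = (glueEnds x y).filterMap fun p => relabel x y (some p) := by
  simp only [Drawing.ends, glueEnds, List.reduceOption_append, reduceOption_concat,
    List.filterMap_append]

theorem Drawing.IsDiagram.equivalence_sameString (hx : x.IsDiagram) : Equivalence x.SameString where
  refl _ := Or.inl rfl
  symm {u v} h := h.imp Eq.symm SimpleGraph.Adj.symm
  trans {u v w} h h' := by
    rcases h with rfl | h
    · exact h'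
    · rcases h' with rfl | h'
      · exact Or.inr h
      · exact Or.inl (hx.adj_unique v u w h.symm h')

/-- The strings of two drawings side by side, before they are glued. -/
def sumSameString (x y : Drawing n) : Node n ⊕ Node n → Node n ⊕ Node n → Prop :=
  Sum.LiftRel x.SameString y.SameString

theorem equivalence_sumSameString (hx : x.IsDiagram) (hy : y.IsDiagram) :
    Equivalence (sumSameString x y) where
  refl
    | .inl a => .inl (hx.equivalence_sameString.refl a)
    | .inr a => .inr (hy.equivalence_sameString.refl a)
  symm
    | .inl h => .inl (hx.equivalence_sameString.symm h)
    | .inr h => .inr (hy.equivalence_sameString.symm h)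
  trans
    | .inl h, .inl h' => .inl (hx.equivalence_sameString.trans h h')
    | .inr h, .inr h' => .inr (hy.equivalence_sameString.trans h h')

/-- The pairs of nodes identified by gluing, from the top to the bottom. -/
def seam (n : ℕ) : List ((Node n ⊕ Node n) × (Node n ⊕ Node n)) :=
  (List.finRange n).map fun i => (Sum.inl (Node.right i), Sum.inr (Node.left i))

def toVertex : Node n ⊕ Node n → Vertex n := Sum.elim Vertex.ofFirst Vertex.ofSecond

/-- Sewing the disjoint union of both sets of nodes along the seam has the same effect as gluing the
graphs: two nodes over the same vertex are equal or form a seam pair. -/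
theorem eqvGen_seam_iff (a b : Node n ⊕ Node n) :
    Relation.EqvGen (fun a b => sumSameString x y a b ∨ (a, b) ∈ seam n) a b ↔
      (glue x y).Reachable (toVertex a) (toVertex b) := by
  have hseam : ∀ i : Fin n, Relation.EqvGen (fun a b => sumSameString x y a b ∨ (a, b) ∈ seam n)
      (Sum.inl (Node.right i)) (Sum.inr (Node.left i)) :=
    fun i => .rel _ _ (Or.inr (by simp [seam]))
  constructor
  · intro h
    induction h with
    | rel a b h =>
      rcases h with (h | h) | h
      · rcases h with rfl | h
        · rfl
        · exact (glue_adj_first h).reachable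
      · rcases h with rfl | h
        · rfl
        · exact (glue_adj_second h).reachable
      · simp only [seam, List.mem_map, Prod.mk.injEq] at h
        obtain ⟨i, -, rfl, rfl⟩ := h
        rfl
    | refl a => rfl
    | symm a b _ ih => exact ih.symm
    | trans a b c _ _ ih ih' => exact ih.trans ih'
  · intro h
    have fiber : ∀ a b : Node n ⊕ Node n, toVertex a = toVertex b →
        Relation.EqvGen (fun a b => sumSameString x y a b ∨ (a, b) ∈ seam n) a b := by
      rintro ((i | i) | (i | i)) ((j | j) | (j | j)) h <;>
        simp only [toVertex, Sum.elim_inl, Sum.elim_inr, Vertex.ofFirst_left, Vertex.ofFirst_right,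
          Vertex.ofSecond_left, Vertex.ofSecond_right, reduceCtorEq, Vertex.left.injEq,
          Vertex.middle.injEq, Vertex.right.injEq] at h <;> subst h
      · exact .refl _
      · exact .refl _
      · exact hseam i
      · exact .symm _ _ (hseam i)
      · exact .refl _
      · exact .refl _
    rw [SimpleGraph.reachable_iff_reflTransGen] at h
    generalize hp : toVertex a = p at h
    generalize hq : toVertex b = q at h
    induction h using Relation.ReflTransGen.head_induction_on generalizing a with
    | refl => exact fiber a b (hp.trans hq.symm)
    | head h _ ih =>
      rcases glue_adj.1 h with ⟨u, v, huv, rfl, rfl⟩ | ⟨u, v, huv, rfl, rfl⟩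
      · exact .trans _ _ _ (fiber a (Sum.inl u) hp)
          (.trans _ _ _ (.rel _ _ (Or.inl (.inl (Or.inr huv)))) (ih (Sum.inl v) rfl))
      · exact .trans _ _ _ (fiber a (Sum.inr u) hp)
          (.trans _ _ _ (.rel _ _ (Or.inl (.inr (Or.inr huv)))) (ih (Sum.inr v) rfl))

/-- The string endpoints around the concatenation, clockwise from the bottom left corner. -/
def gluePerimeter (x y : Drawing n) : List (Vertex n) :=
  (List.finRange n).reverse.map Vertex.left ++ (glueWord x y Side.top).reduceOption ++
    (List.finRange n).map Vertex.right ++ (glueWord x y Side.bottom).reverse.reduceOption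

theorem nonCrossing_gluePerimeter (hx : x.IsDiagram) (hy : y.IsDiagram) :
    NonCrossing (glue x y).Reachable (gluePerimeter x y) := by
  have hr := equivalence_sumSameString hx hy
  have h1 : NonCrossing (sumSameString x y)
      (((x.word Side.bottom).reverse.reduceOption ++ ((List.finRange n).reverse.map Node.left ++
        (x.word Side.top).reduceOption ++ (List.finRange n).map Node.right)).map Sum.inl) := by
    refine NonCrossing.map (r := x.SameString) ?_ fun a b => by simp [sumSameString]
    -- The bottom word of `x` moves to the front, so that the right nodes come last and face the
    -- left nodes of `y`.
    exact NonCrossing.rotate hx.equivalence_sameString hx.noncrossing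
  have h2 : NonCrossing (sumSameString x y) (y.perimeter.map Sum.inr) :=
    NonCrossing.map (r := y.SameString) hy.noncrossing fun a b => by simp [sumSameString]
  have h3 := NonCrossing.append h1 h2 (by
    intro a ha b hb h
    obtain ⟨u, -, rfl⟩ := List.mem_map.1 ha
    obtain ⟨v, -, rfl⟩ := List.mem_map.1 hb
    cases h)
  have h4 := NonCrossing.sew (seam n) hr
    (l := ((x.word Side.bottom).reverse.reduceOption ++ ((List.finRange n).reverse.map Node.left ++
        (x.word Side.top).reduceOption)).map Sum.inl)
    (l' := ((y.word Side.top).reduceOption ++ (List.finRange n).map Node.right ++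
      (y.word Side.bottom).reverse.reduceOption).map Sum.inr)
    (by
      convert h3 using 1
      simp [seam, Drawing.perimeter, Function.comp_def])
  have h5 := h4.map (s := (glue x y).Reachable) (f := toVertex) eqvGen_seam_iff
  -- The bottom word of `x` returns to the end, behind the reversed bottom word of `y`.
  have h6 := NonCrossing.rotate (SimpleGraph.reachable_is_equivalence _)
    (l := ((x.word Side.bottom).reverse.reduceOption).map Vertex.ofFirst)
    (l' := (List.finRange n).reverse.map Vertex.left ++ (glueWord x y Side.top).reduceOption ++
      (List.finRange n).map Vertex.right ++
      ((y.word Side.bottom).reverse.reduceOption).map Vertex.ofSecond) (by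
      convert h5 using 1
      simp [toVertex, Function.comp_def, glueWord, List.reduceOption_append,
        List.reduceOption_map])
  convert h6 using 1
  simp [gluePerimeter, glueWord, List.reduceOption_append, ← List.map_reverse,
    List.reduceOption_map]

theorem sameString_concat {v w : Node n} : (concat x y).SameString v w ↔
    (glue x y).Reachable (Vertex.outer v) (Vertex.outer w) := by
  unfold Drawing.SameString
  constructor
  · rintro (rfl | h)
    · rfl
    · exact h.2
  · intro h
    by_cases hvw : v = w
    · exact Or.inl hvw
    · exact Or.inr ⟨hvw, h⟩

theorem reduceOption_reverse {α : Type*} (l : List (Option α)) :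
    l.reverse.reduceOption = l.reduceOption.reverse := by
  simp [List.reduceOption, List.filterMap_reverse]

theorem mem_glueEnds_of_mem_glueWord {s : Side} {p : Vertex n} (h : some p ∈ glueWord x y s) :
    p ∈ glueEnds x y := by
  rw [glueEnds, List.reduceOption_mem_iff, List.mem_append]
  cases s
  exacts [Or.inl h, Or.inr h]

theorem nonCrossing_concat (hx : x.IsDiagram) (hy : y.IsDiagram) :
    NonCrossing (concat x y).SameString (concat x y).perimeter := by
  -- On outer vertices `relabel` might choose the other end of the string, so `φ` fixes them; at
  -- boundary ends it still agrees with `relabel`.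
  let φ : Vertex n → Option (Node n)
    | Vertex.left i => some (Node.left i)
    | Vertex.middle i => relabel x y (some (Vertex.middle i))
    | Vertex.right i => some (Node.right i)
  have hφ : ∀ p v, φ p = some v → (glue x y).Reachable (Vertex.outer v) p := by
    rintro (i | i | i) v h
    · obtain rfl : Node.left i = v := Option.some.inj h
      rfl
    · exact reachable_of_relabel_eq_some h
    · obtain rfl : Node.right i = v := Option.some.inj h
      rfl
  have hφ' : ∀ p ∈ glueEnds x y, φ p = relabel x y (some p) := by
    rintro (i | i | i) hp
    · exact ((relabel_eq_some_iff hx hy hp).2 (SimpleGraph.Reachable.refl _)).symm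
    · rfl
    · exact ((relabel_eq_some_iff hx hy hp).2 (SimpleGraph.Reachable.refl _)).symm
  have h := (nonCrossing_gluePerimeter hx hy).filterMap (φ := φ) (s := (concat x y).SameString)
    fun a b c d hc hd => by
      rw [sameString_concat]
      exact ⟨fun h => ((hφ _ _ hc).trans h).trans (hφ _ _ hd).symm,
        fun h => ((hφ _ _ hc).symm.trans h).trans (hφ _ _ hd)⟩
  convert h using 1
  have hw : ∀ s, ((glueWord x y s).reduceOption.filterMap φ) =
      ((concat x y).word s).reduceOption := by
    intro s
    rw [reduceOption_concat]
    refine List.filterMap_congr fun p hp => hφ' p ?_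
    exact mem_glueEnds_of_mem_glueWord (List.reduceOption_mem_iff.1 hp)
  simp only [Drawing.perimeter, gluePerimeter, List.filterMap_append, reduceOption_reverse,
    List.filterMap_reverse, hw, List.filterMap_map]
  congr 1
  congr 1
  · congr 1
    rw [List.map_reverse, ← List.filterMap_eq_map]
    rfl
  · rw [← List.filterMap_eq_map]
    rfl

/-- The concatenation of two diagrams is a diagram. -/
theorem isDiagram_concat (hx : x.IsDiagram) (hy : y.IsDiagram) : (concat x y).IsDiagram where
  adj_unique u v w hv hw := eq_of_reachable_outer hx hy hv.1 hw.1 hv.2 hw.2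
  nodup := by
    change (concat x y).ends.Nodup
    rw [ends_concat, List.Nodup, List.pairwise_filterMap]
    refine (pairwise_glueEnds hx hy).imp fun {p q} h a ha b hb hab => ?_
    subst hab
    have ha' := reachable_of_relabel_eq_some ha
    exact h (ha'.symm.trans (reachable_of_relabel_eq_some hb)) a ha'
  not_adj s v w hv hvw := by
    have : v ∈ (concat x y).ends := Drawing.mem_ends.2 ⟨s, hv⟩
    rw [ends_concat, List.mem_filterMap] at this
    obtain ⟨p, hp, hpv⟩ := this
    have hpv' := reachable_of_relabel_eq_some hpv
    exact hvw.1 (eq_of_reachable_end hx hy hp hpv' (hvw.2.symm.trans hpv'))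
  reduced s := isChain_removePairs _
  even s := by
    rw [concat, even_length_removePairs, List.length_map, glueWord, List.length_append,
      List.length_map, List.length_map]
    exact (hx.even s).add (hy.even s)
  noncrossing := nonCrossing_concat hx hy

end

/-! ### Occupied nodes of a concatenation, and weights -/

section

theorem exists_adj_of_reachable_of_ne {V : Type*} {G : SimpleGraph V} {p q : V}
    (h : G.Reachable p q) (hne : p ≠ q) : ∃ r, G.Adj p r := by
  obtain ⟨w⟩ := h
  cases w with
  | nil => exact absurd rfl hne
  | cons h _ => exact ⟨_, h⟩

/-- The partner map is an involution of `S` without fixed points, so the ones cancel in pairs modulo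
`2`. -/
theorem even_card_of_matching {V : Type*} (G : SimpleGraph V)
    (hG : ∀ u v w, G.Adj u v → G.Adj u w → v = w) (S : Finset V)
    (hS : ∀ u ∈ S, ∃ w ∈ S, G.Adj u w) : Even S.card := by
  choose! f hf hadj using hS
  have h : ∑ _u ∈ S, (1 : ZMod 2) = 0 :=
    Finset.sum_involution (fun u _ => f u) (fun _ _ => by decide)
      (fun u hu _ => (hadj u hu).ne') hf
      fun u hu => hG (f u) _ _ (hadj _ (hf u hu)) (hadj u hu).symm
  rw [Finset.sum_const, nsmul_eq_mul, mul_one] at h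
  exact ZMod.natCast_eq_zero_iff_even.1 h

variable {n : ℕ} {x y : Drawing n}

theorem sum_node (f : Node n → ℕ) :
    ∑ u, f u = ∑ i, f (Node.left i) + ∑ i, f (Node.right i) := by
  rw [← (nodeEquiv n).symm.sum_comp, Fintype.sum_sum_type]
  rfl

/-- In the concatenation, the vertex `p` has a string attached to it. -/
def GlueOccupied (x y : Drawing n) (p : Vertex n) : Prop :=
  (∃ q, (glue x y).Adj p q) ∨ p ∈ glueEnds x y

theorem Drawing.occupied_iff {d : Drawing n} {v : Node n} :
    d.Occupied v ↔ (∃ w, d.strings.Adj v w) ∨ v ∈ d.ends := by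
  rw [Drawing.Occupied, Drawing.mem_ends]

theorem glueOccupied_left {i : Fin n} :
    GlueOccupied x y (Vertex.left i) ↔ x.Occupied (Node.left i) := by
  rw [GlueOccupied, Drawing.occupied_iff, mem_glueEnds]
  refine or_congr ⟨?_, ?_⟩ ⟨?_, ?_⟩
  · rintro ⟨q, hq⟩
    rcases glue_adj.1 hq with ⟨u, v, huv, h, rfl⟩ | ⟨u, v, huv, h, rfl⟩
    · rcases u with j | j <;> simp only [Vertex.ofFirst_left, Vertex.ofFirst_right,
        Vertex.left.injEq, reduceCtorEq] at h
      subst h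
      exact ⟨v, huv⟩
    · rcases u with j | j <;> simp at h
  · rintro ⟨w, h⟩
    exact ⟨_, glue_adj_first h⟩
  · rintro (⟨j | j, h, h'⟩ | ⟨j | j, h, h'⟩) <;> simp at h'
    exact h' ▸ h
  · exact fun h => Or.inl ⟨_, h, rfl⟩

theorem glueOccupied_right {i : Fin n} :
    GlueOccupied x y (Vertex.right i) ↔ y.Occupied (Node.right i) := by
  rw [GlueOccupied, Drawing.occupied_iff, mem_glueEnds]
  refine or_congr ⟨?_, ?_⟩ ⟨?_, ?_⟩
  · rintro ⟨q, hq⟩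
    rcases glue_adj.1 hq with ⟨u, v, huv, h, rfl⟩ | ⟨u, v, huv, h, rfl⟩
    · rcases u with j | j <;> simp at h
    · rcases u with j | j <;> simp only [Vertex.ofSecond_left, Vertex.ofSecond_right,
        Vertex.right.injEq, reduceCtorEq] at h
      subst h
      exact ⟨v, huv⟩
  · rintro ⟨w, h⟩
    exact ⟨_, glue_adj_second h⟩
  · rintro (⟨j | j, h, h'⟩ | ⟨j | j, h, h'⟩) <;> simp at h'
    exact h' ▸ h
  · exact fun h => Or.inr ⟨_, h, rfl⟩

/-- A middle vertex that has a string and is not at a string to a boundary has strings to other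
nodes on both of its sides. -/
theorem exists_adj_of_middle (hc : Compatible x y) {i : Fin n}
    (h : ∃ q, (glue x y).Adj (Vertex.middle i) q) (he : Vertex.middle i ∉ glueEnds x y) :
    (∃ v, x.strings.Adj (Node.right i) v) ∧ ∃ v, y.strings.Adj (Node.left i) v := by
  have hx : Node.right i ∉ x.ends := fun h' => he (mem_glueEnds.2 (Or.inl ⟨_, h', rfl⟩))
  have hy : Node.left i ∉ y.ends := fun h' => he (mem_glueEnds.2 (Or.inr ⟨_, h', rfl⟩))
  have hc' := hc i
  rw [Drawing.occupied_iff, Drawing.occupied_iff, or_iff_left hx, or_iff_left hy] at hc'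
  obtain ⟨q, hq⟩ := h
  rcases glue_adj.1 hq with ⟨u, v, huv, h, rfl⟩ | ⟨u, v, huv, h, rfl⟩
  · rcases u with j | j <;> simp only [Vertex.ofFirst_left, Vertex.ofFirst_right,
      Vertex.middle.injEq, reduceCtorEq] at h
    subst h
    exact ⟨⟨v, huv⟩, hc'.1 ⟨v, huv⟩⟩
  · rcases u with j | j <;> simp only [Vertex.ofSecond_left, Vertex.ofSecond_right,
      Vertex.middle.injEq, reduceCtorEq] at h
    subst h
    exact ⟨hc'.2 ⟨v, huv⟩, ⟨v, huv⟩⟩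

/-- The point is that a string starting at an outer node has a second end. Otherwise `v` would be
the only end of its component, and compatibility would give every node of the component, in either
rectangle, a partner by a string of that rectangle. -/
theorem occupied_concat_iff (hx : x.IsDiagram) (hy : y.IsDiagram) (hc : Compatible x y)
    (v : Node n) : (concat x y).Occupied v ↔ GlueOccupied x y (Vertex.outer v) := by
  classical
  rw [Drawing.occupied_iff, ends_concat, List.mem_filterMap]
  constructor
  · rintro (⟨w, hw⟩ | ⟨p, hp, hpv⟩)
    · exact Or.inl (exists_adj_of_reachable_of_ne hw.2 (Vertex.outer_injective.ne hw.1))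
    · by_cases h : Vertex.outer v = p
      · exact Or.inr (h ▸ hp)
      · exact Or.inl (exists_adj_of_reachable_of_ne (reachable_of_relabel_eq_some hpv) h)
  · intro hv
    by_contra hcon
    push Not at hcon
    obtain ⟨hcon1, hcon2⟩ := hcon
    have hE : ∀ p, (glue x y).Reachable (Vertex.outer v) p → p ∉ glueEnds x y :=
      fun p hp hpe => hcon2 p hpe ((relabel_eq_some_iff hx hy hpe).2 hp)
    have hO : ∀ w, (glue x y).Reachable (Vertex.outer v) (Vertex.outer w) ↔ v = w := by
      intro w
      refine ⟨fun h => ?_, ?_⟩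
      · by_contra hne
        exact hcon1 w ⟨hne, h⟩
      · rintro rfl
        rfl
    have hadj : ∀ p, (glue x y).Reachable (Vertex.outer v) p → ∃ q, (glue x y).Adj p q := by
      intro p hp
      by_cases h : Vertex.outer v = p
      · subst h
        exact hv.resolve_right (hE _ hp)
      · exact exists_adj_of_reachable_of_ne hp.symm (Ne.symm h)
    have hS := even_card_of_matching x.strings hx.adj_unique
      (Finset.univ.filter fun u => (glue x y).Reachable (Vertex.outer v) (Vertex.ofFirst u)) (by
        intro u hu
        simp only [Finset.mem_filter, Finset.mem_univ, true_and] at hu ⊢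
        suffices h : ∃ w, x.strings.Adj u w by
          obtain ⟨w, hw⟩ := h
          exact ⟨w, hu.trans (glue_adj_first hw).reachable, hw⟩
        rcases u with i | i
        · exact ((Drawing.occupied_iff.1 (glueOccupied_left.1 (Or.inl (hadj _ hu))))).resolve_right
            fun h => hE _ hu (mem_glueEnds.2 (Or.inl ⟨_, h, rfl⟩))
        · exact (exists_adj_of_middle hc (hadj _ hu) (hE _ hu)).1)
    have hT := even_card_of_matching y.strings hy.adj_unique
      (Finset.univ.filter fun u => (glue x y).Reachable (Vertex.outer v) (Vertex.ofSecond u)) (by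
        intro u hu
        simp only [Finset.mem_filter, Finset.mem_univ, true_and] at hu ⊢
        suffices h : ∃ w, y.strings.Adj u w by
          obtain ⟨w, hw⟩ := h
          exact ⟨w, hu.trans (glue_adj_second hw).reachable, hw⟩
        rcases u with i | i
        · exact (exists_adj_of_middle hc (hadj _ hu) (hE _ hu)).2
        · exact ((Drawing.occupied_iff.1 (glueOccupied_right.1 (Or.inl (hadj _ hu))))).resolve_right
            fun h => hE _ hu (mem_glueEnds.2 (Or.inr ⟨_, h, rfl⟩)))
    have h1 : (Finset.univ.filter fun u =>
        (glue x y).Reachable (Vertex.outer v) (Vertex.outer u)).card = 1 := by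
      simp [hO, Finset.filter_eq]
    let c : Vertex n → ℕ := fun p => if (glue x y).Reachable (Vertex.outer v) p then 1 else 0
    have key : ∀ f : Node n → Vertex n,
        (Finset.univ.filter fun u => (glue x y).Reachable (Vertex.outer v) (f u)).card =
          ∑ i, c (f (Node.left i)) + ∑ i, c (f (Node.right i)) := by
      intro f
      rw [Finset.card_filter, sum_node]
    rw [key] at hS hT h1
    simp only [Vertex.ofFirst_left, Vertex.ofFirst_right, Vertex.ofSecond_left,
      Vertex.ofSecond_right, Vertex.outer_left, Vertex.outer_right] at hS hT h1
    rw [Nat.even_iff] at hS hT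
    -- Counting the left, middle and right vertices of the component, left plus middle and middle
    -- plus right are even, but left plus right is `1`.
    omega

/-! ### Weights in terms of marks -/

/-- The marks on both boundaries. -/
def taggedMarks {α : Type} (W : Side → List (Option α)) : List (Side × Bool × α) :=
  (marks true (W Side.top)).map (Prod.mk Side.top) ++
    (marks true (W Side.bottom)).map (Prod.mk Side.bottom)

theorem map_taggedMarks_glueWord (x y : Drawing n) :
    (taggedMarks (glueWord x y)).map (fun m => m.2.2) = glueEnds x y := by
  rw [glueEnds, List.reduceOption_append, ← map_snd_marks true, ← map_snd_marks true, taggedMarks,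
    List.map_append, List.map_map, List.map_map]
  rfl

section Weights

variable {R : Type*}

/-- The parameter of an arc, in terms of the boundaries and of the parities of the positions of its
ends (`true` for odd). -/
def Params.arc (P : Params R) : Side → Bool → Side → Bool → R
  -- The positions `1` and `2` represent the two parities.
  | Side.top, b, Side.bottom, b' => P.topBottom (if b then 1 else 2) (if b' then 1 else 2)
  -- The value for a bottom end followed by a top end is arbitrary: in `taggedMarks` all top marks
  -- come first.
  | s, b, _, b' => P.sameSide s (if b then 1 else 2) (if b' then 1 else 2)

theorem Params.sameSide_eq (P : Params R) (s : Side) (k l : ℕ) :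
    P.sameSide s (k + 1) (l + 1) =
      P.arc s (if Even k then true else !true) s (if Even l then true else !true) := by
  cases s <;> by_cases hk : Even k <;> by_cases hl : Even l <;>
    simp [Params.arc, Params.sameSide, hk, hl, Nat.even_add_one, Nat.not_even_iff_odd.symm]

theorem Params.topBottom_eq (P : Params R) (k l : ℕ) :
    P.topBottom (k + 1) (l + 1) =
      P.arc Side.top (if Even k then true else !true) Side.bottom
        (if Even l then true else !true) := by
  by_cases hk : Even k <;> by_cases hl : Even l <;>
    simp [Params.arc, Params.topBottom, hk, hl, Nat.even_add_one]

variable [CommRing R] (P : Params R)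

open scoped Classical in
/-- The parameter of the arc between two marks if they are related by `r`, and `1` otherwise. -/
def arcFactor {α : Type} (r : α → α → Prop) (m m' : Side × Bool × α) : R :=
  if r m.2.2 m'.2.2 then P.arc m.1 m.2.1 m'.1 m'.2.1 else 1

/-- The product of the parameters of all arcs, that is, pairs of marks related by `r`. -/
def arcWeight {α : Type} (r : α → α → Prop) : List (Side × Bool × α) → R :=
  pairProd (arcFactor P r)

theorem sameSideWeight_eq (x y : Drawing n) (s : Side) :
    sameSideWeight P x y s = arcWeight P (glue x y).Reachable
      ((marks true (glueWord x y s)).map (Prod.mk s)) := by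
  rw [arcWeight, pairProd_map, sameSideWeight]
  refine Eq.trans ?_ (prod_range_range_marks (fun b p b' q =>
    arcFactor P (glue x y).Reachable (s, b, p) (s, b', q)) true _)
  refine Finset.prod_congr rfl fun l _ => Finset.prod_congr rfl fun k _ => ?_
  rw [Params.sameSide_eq]
  unfold Joined
  rcases (glueWord x y s)[k]? with _ | _ | p <;> rcases (glueWord x y s)[l]? with _ | _ | q <;>
    first
      | exact if_neg (by simp)
      | (unfold arcFactor; congr 1; simp)

theorem topBottomWeight_eq (x y : Drawing n) :
    topBottomWeight P x y = ((marks true (glueWord x y Side.top)).map fun m =>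
      ((marks true (glueWord x y Side.bottom)).map fun m' =>
        arcFactor P (glue x y).Reachable (Side.top, m) (Side.bottom, m')).prod).prod := by
  rw [topBottomWeight]
  refine Eq.trans ?_ (prod_range_marks (fun b p =>
    ((marks true (glueWord x y Side.bottom)).map fun m' =>
        arcFactor P (glue x y).Reachable (Side.top, b, p) (Side.bottom, m')).prod) true _)
  refine Finset.prod_congr rfl fun k _ => ?_
  unfold Joined
  rcases (glueWord x y Side.top)[k]? with _ | _ | p
  · simp
  · simp
  · refine Eq.trans ?_ (prod_range_marks (fun b' q => arcFactor P (glue x y).Reachable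
      (Side.top, (if Even k then true else !true), p) (Side.bottom, b', q)) true _)
    refine Finset.prod_congr rfl fun l _ => ?_
    rw [Params.topBottom_eq]
    rcases (glueWord x y Side.bottom)[l]? with _ | _ | q <;>
      first
        | exact if_neg (by simp)
        | (unfold arcFactor; congr 1; simp)

/-- Pairs in the joint list of marks are pairs on the top, pairs on the bottom, or a top mark with a
bottom mark, which accounts for the three arc products. -/
theorem weight_eq (x y : Drawing n) :
    weight P x y = P.β ^ (loops x y).ncard *
      arcWeight P (glue x y).Reachable (taggedMarks (glueWord x y)) := by
  rw [weight, taggedMarks, arcWeight, pairProd_append, sameSideWeight_eq, sameSideWeight_eq,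
    topBottomWeight_eq, mul_assoc, mul_assoc, mul_assoc]
  simp only [List.map_map, Function.comp_def, arcWeight]

end Weights

end

/-! ### A concatenation nested in a larger one -/

section

variable {n : ℕ} {V : Type}

/-- The graph `G` consists of the concatenation of `x` and `y`, placed by `j`, and of the strings of a
further drawing. The latter meet the former in outer nodes only, and the concatenation of `X` and `Y`,
placed by `k`, is obtained from `G` when `x` and `y` are replaced by `concat x y`. -/
structure Nested (G : SimpleGraph V) (x y X Y : Drawing n) (j k : Vertex n → V)
    (e : Node n → Vertex n) (B : SimpleGraph (Vertex n)) : Prop where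
  j_injective : Function.Injective j
  k_injective : Function.Injective k
  k_e : ∀ a, k (e a) = j (Vertex.outer a)
  exists_of_eq : ∀ u p, k u = j p → ∃ a, u = e a ∧ p = Vertex.outer a
  range : ∀ w, (∃ p, w = j p) ∨ ∃ u, w = k u
  adj_iff : ∀ p q, G.Adj p q ↔ (∃ a b, (glue x y).Adj a b ∧ j a = p ∧ j b = q) ∨
    ∃ u v, B.Adj u v ∧ k u = p ∧ k v = q
  adj_iff' : ∀ u v, (glue X Y).Adj u v ↔
    (∃ a b, (concat x y).strings.Adj a b ∧ e a = u ∧ e b = v) ∨ B.Adj u v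

namespace Nested

variable {G : SimpleGraph V} {x y X Y : Drawing n} {j k : Vertex n → V}
  {e : Node n → Vertex n} {B : SimpleGraph (Vertex n)}

theorem reachable_inner (h : Nested G x y X Y j k e B) {p q : Vertex n}
    (hpq : (glue x y).Reachable p q) : G.Reachable (j p) (j q) :=
  hpq.map (⟨j, fun {a b} hab => (h.adj_iff _ _).2 (Or.inl ⟨a, b, hab, rfl, rfl⟩)⟩ :
    glue x y →g G)

theorem reachable_outer_concat (h : Nested G x y X Y j k e B) {a b : Node n}
    (hab : (glue x y).Reachable (Vertex.outer a) (Vertex.outer b)) :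
    (glue X Y).Reachable (e a) (e b) := by
  by_cases hne : a = b
  · rw [hne]
  · exact SimpleGraph.Adj.reachable ((h.adj_iff' _ _).2 (Or.inl ⟨a, b, ⟨hne, hab⟩, rfl, rfl⟩))

theorem reachable_of_reachable_outer (h : Nested G x y X Y j k e B) {u v : Vertex n}
    (huv : (glue X Y).Reachable u v) : G.Reachable (k u) (k v) := by
  rw [SimpleGraph.reachable_iff_reflTransGen] at huv
  induction huv with
  | refl => rfl
  | tail _ hadj ih =>
    refine ih.trans ?_
    rcases (h.adj_iff' _ _).1 hadj with ⟨a, b, hab, rfl, rfl⟩ | hB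
    · rw [h.k_e, h.k_e]
      exact h.reachable_inner hab.2
    · exact SimpleGraph.Adj.reachable ((h.adj_iff _ _).2 (Or.inr ⟨_, _, hB, rfl, rfl⟩))

/-- Induction along a walk that may enter the inner concatenation. While it is inside, the invariant
remembers an outer node `a` of the inner part on the same inner string, so that leaving again is a
step along a string of `concat x y`. -/
theorem reachable_from_outer (h : Nested G x y X Y j k e B) {u : Vertex n} {w : V}
    (huw : G.Reachable (k u) w) :
    (∀ v, w = k v → (glue X Y).Reachable u v) ∧
      ∀ q, w = j q →
        ∃ a, (glue X Y).Reachable u (e a) ∧ (glue x y).Reachable (Vertex.outer a) q := by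
  rw [SimpleGraph.reachable_iff_reflTransGen] at huw
  induction huw with
  | refl =>
    refine ⟨fun v hv => by rw [h.k_injective hv], fun q hq => ?_⟩
    obtain ⟨a, rfl, rfl⟩ := h.exists_of_eq _ _ hq
    exact ⟨a, SimpleGraph.Reachable.refl _, SimpleGraph.Reachable.refl _⟩
  | tail _ hadj ih =>
    rcases (h.adj_iff _ _).1 hadj with ⟨a, b, hab, rfl, rfl⟩ | ⟨a, b, hab, rfl, rfl⟩
    · obtain ⟨c, hc, hca⟩ := ih.2 a rfl
      have hcb := hca.trans hab.reachable
      refine ⟨fun v hv => ?_, fun q hq => ?_⟩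
      · obtain ⟨d, rfl, rfl⟩ := h.exists_of_eq _ _ hv.symm
        exact hc.trans (h.reachable_outer_concat hcb)
      · rw [← h.j_injective hq]
        exact ⟨c, hc, hcb⟩
    · have hb := (ih.1 a rfl).trans (SimpleGraph.Adj.reachable ((h.adj_iff' _ _).2 (Or.inr hab)))
      refine ⟨fun v hv => ?_, fun q hq => ?_⟩
      · rwa [← h.k_injective hv]
      · obtain ⟨d, rfl, rfl⟩ := h.exists_of_eq _ _ hq
        exact ⟨d, hb, SimpleGraph.Reachable.refl _⟩

theorem reachable_outer_iff (h : Nested G x y X Y j k e B) {u v : Vertex n} :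
    G.Reachable (k u) (k v) ↔ (glue X Y).Reachable u v :=
  ⟨fun huv => (h.reachable_from_outer huv).1 v rfl, h.reachable_of_reachable_outer⟩

/-- The strings of the further drawing meet the inner concatenation in outer nodes only, so a
component without outer nodes cannot be left. -/
theorem reachable_from_closed (h : Nested G x y X Y j k e B) {p : Vertex n} {w : V}
    (hp : ∀ v, ¬ (glue x y).Reachable (Vertex.outer v) p) (hpw : G.Reachable (j p) w) :
    ∃ q, w = j q ∧ (glue x y).Reachable p q := by
  rw [SimpleGraph.reachable_iff_reflTransGen] at hpw
  induction hpw with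
  | refl => exact ⟨p, rfl, SimpleGraph.Reachable.refl _⟩
  | tail _ hadj ih =>
    obtain ⟨q, rfl, hq⟩ := ih
    rcases (h.adj_iff _ _).1 hadj with ⟨a, b, hab, ha, rfl⟩ | ⟨a, b, hab, ha, rfl⟩
    · rw [h.j_injective ha] at hab
      exact ⟨b, rfl, hq.trans hab.reachable⟩
    · obtain ⟨d, rfl, rfl⟩ := h.exists_of_eq _ _ ha
      exact absurd hq.symm (hp d)

theorem not_reachable_closed_outer (h : Nested G x y X Y j k e B) {p u : Vertex n}
    (hp : ∀ v, ¬ (glue x y).Reachable (Vertex.outer v) p) : ¬ G.Reachable (j p) (k u) := by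
  intro hpu
  obtain ⟨q, hq, hpq⟩ := h.reachable_from_closed hp hpu
  obtain ⟨a, rfl, rfl⟩ := h.exists_of_eq _ _ hq
  exact hp a hpq.symm

/-- The vertex of the concatenation of `X` and `Y` where a string of `G` to the boundary ends, when
`x` and `y` are replaced by `concat x y`. -/
def residual (x y : Drawing n) (e : Node n → Vertex n) : Vertex n ⊕ Vertex n → Option (Vertex n) :=
  Sum.elim (fun p => (relabel x y (some p)).map e) some

theorem residual_inl_of_none {p : Vertex n} (hp : residual x y e (Sum.inl p) = none) (v : Node n) :
    ¬ (glue x y).Reachable (Vertex.outer v) p :=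
  relabel_eq_none_iff.1 (by simpa [residual] using hp) v

theorem reachable_residual (h : Nested G x y X Y j k e B) {l : Vertex n ⊕ Vertex n} {u : Vertex n}
    (hl : residual x y e l = some u) : G.Reachable (Sum.elim j k l) (k u) := by
  rcases l with p | v
  · simp only [residual, Sum.elim_inl, Option.map_eq_some_iff] at hl
    obtain ⟨a, ha, rfl⟩ := hl
    rw [h.k_e]
    exact h.reachable_inner (reachable_of_relabel_eq_some ha).symm
  · rw [Option.some.inj hl]
    rfl

theorem not_reachable_outer_of_residual_eq_none (h : Nested G x y X Y j k e B)
    {l : Vertex n ⊕ Vertex n} (hl : residual x y e l = none) (u : Vertex n) :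
    ¬ G.Reachable (Sum.elim j k l) (k u) := by
  rcases l with p | v
  · exact h.not_reachable_closed_outer (residual_inl_of_none hl)
  · simp [residual] at hl

/-! ### Weights -/

section Weights

variable {R : Type*} [CommRing R] (P : Params R)

theorem _root_.DiluteGhost.arcFactor_congr {α α' : Type} {r : α → α → Prop} {r' : α' → α' → Prop}
    {a b : α} {a' b' : α'} (h : r a b ↔ r' a' b') (s t : Side) (c d : Bool) :
    arcFactor P r (s, c, a) (t, d, b) = arcFactor P r' (s, c, a') (t, d, b') := by
  by_cases hr : r a b
  · exact (if_pos hr).trans (if_pos (h.1 hr)).symm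
  · exact (if_neg hr).trans (if_neg (mt h.2 hr)).symm

/-- Each pair of marks contributes to at most one factor on the right, depending on whether the
string through its first mark is closed off in the inner product or survives into the outer one. The
hypothesis `hZ` rules out that a surviving string also forms an inner arc. -/
theorem arcWeight_eq (h : Nested G x y X Y j k e B)
    (Z : List (Side × Bool × (Vertex n ⊕ Vertex n)))
    (hZ : (Z.filterMap fun m => m.2.2.getLeft?).Pairwise fun p q =>
      (glue x y).Reachable p q → ∀ v, ¬ (glue x y).Reachable (Vertex.outer v) p) :
    arcWeight P G.Reachable (Z.map fun m => (m.1, m.2.1, Sum.elim j k m.2.2)) =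
      arcWeight P (glue x y).Reachable
          (Z.filterMap fun m => m.2.2.getLeft?.map fun a => (m.1, m.2.1, a)) *
        arcWeight P (glue X Y).Reachable
          (Z.filterMap fun m => (residual x y e m.2.2).map fun a => (m.1, m.2.1, a)) := by
  rw [arcWeight, arcWeight, arcWeight, pairProd_map, pairProd_filterMap, pairProd_filterMap,
    ← pairProd_mul]
  rw [List.pairwise_filterMap] at hZ
  refine pairProd_congr (hZ.imp ?_)
  rintro ⟨s, b, l⟩ ⟨t, c, l'⟩ hll
  rcases hl : residual x y e l with _ | u
  · have hH : extendOne (fun m : Side × Bool × (Vertex n ⊕ Vertex n) =>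
        (residual x y e m.2.2).map fun a => (m.1, m.2.1, a))
        (arcFactor P (glue X Y).Reachable) (s, b, l) (t, c, l') = 1 := by
      simp [extendOne, hl]
    rw [hH, mul_one]
    rcases l with p | v
    · rcases l' with q | v
      · refine arcFactor_congr P (r := G.Reachable) (r' := (glue x y).Reachable)
          ⟨fun hr => ?_, h.reachable_inner⟩ s t b c
        obtain ⟨q', hq, hpq⟩ := h.reachable_from_closed (residual_inl_of_none hl) hr
        rwa [h.j_injective hq]
      · exact if_neg (h.not_reachable_closed_outer (residual_inl_of_none hl))
    · simp [residual] at hl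
  · have hI : extendOne (fun m : Side × Bool × (Vertex n ⊕ Vertex n) =>
        m.2.2.getLeft?.map fun a => (m.1, m.2.1, a))
        (arcFactor P (glue x y).Reachable) (s, b, l) (t, c, l') = 1 := by
      rcases l with p | v
      · rcases l' with q | v
        · refine if_neg fun hpq => ?_
          simp only [residual, Sum.elim_inl, Option.map_eq_some_iff] at hl
          obtain ⟨a, ha, -⟩ := hl
          exact hll p rfl q rfl hpq a (reachable_of_relabel_eq_some ha)
        · rfl
      · rfl
    rw [hI, one_mul]
    have hu := h.reachable_residual hl
    rcases hl' : residual x y e l' with _ | u'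
    · have hH : extendOne (fun m : Side × Bool × (Vertex n ⊕ Vertex n) =>
          (residual x y e m.2.2).map fun a => (m.1, m.2.1, a))
          (arcFactor P (glue X Y).Reachable) (s, b, l) (t, c, l') = 1 := by
        simp [extendOne, hl, hl']
      rw [hH]
      exact if_neg fun hr => h.not_reachable_outer_of_residual_eq_none hl' u (hr.symm.trans hu)
    · have hu' := h.reachable_residual hl'
      have hH : extendOne (fun m : Side × Bool × (Vertex n ⊕ Vertex n) =>
          (residual x y e m.2.2).map fun a => (m.1, m.2.1, a))
          (arcFactor P (glue X Y).Reachable) (s, b, l) (t, c, l') =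
            arcFactor P (glue X Y).Reachable (s, b, u) (t, c, u') := by
        simp [extendOne, hl, hl']
      rw [hH]
      refine arcFactor_congr P (r := G.Reachable) (r' := (glue X Y).Reachable) ?_ s t b c
      rw [← h.reachable_outer_iff]
      exact ⟨fun hr => (hu.symm.trans hr).trans hu', fun hr => (hu.trans hr).trans hu'.symm⟩

end Weights

/-! ### Words -/

open scoped Classical in
/-- The outer node at the end of the string through `p`, if there is one. -/
def outerEnd (G : SimpleGraph V) (o : Node n → V) (p : V) : Option (Node n) :=
  if h : ∃ v, G.Reachable (o v) p then some h.choose else none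

/-- Relabelling in two stages finds the end of the string in `G`, a description that involves only
`G` and the places of the outer nodes. -/
theorem relabel_residual (h : Nested G x y X Y j k e B) (hX : X.IsDiagram) (hY : Y.IsDiagram)
    {l : Vertex n ⊕ Vertex n} (hl : ∀ u, residual x y e l = some u → u ∈ glueEnds X Y) :
    ((residual x y e l).bind fun u => relabel X Y (some u)) =
      outerEnd G (fun v => k (Vertex.outer v)) (Sum.elim j k l) := by
  rcases hr : residual x y e l with _ | u
  · rw [outerEnd, dif_neg]
    · rfl
    · rintro ⟨v, hv⟩
      exact h.not_reachable_outer_of_residual_eq_none hr _ hv.symm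
  · have hu := h.reachable_residual hr
    have hiff : ∀ v, G.Reachable (k (Vertex.outer v)) (Sum.elim j k l) ↔
        (glue X Y).Reachable (Vertex.outer v) u := by
      intro v
      rw [← h.reachable_outer_iff]
      exact ⟨fun hv => hv.trans hu, fun hv => hv.trans hu.symm⟩
    rw [Option.bind_some, outerEnd]
    split_ifs with hv
    · exact (relabel_eq_some_iff hX hY (hl u hr)).2 ((hiff _).1 hv.choose_spec)
    · rw [relabel_eq_none_iff]
      exact fun v hv' => hv ⟨v, (hiff v).2 hv'⟩

/-! ### Loops -/

/-- The node `v` is joined to another node. -/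
def _root_.DiluteGhost.Drawing.Linked (d : Drawing n) (v : Node n) : Prop :=
  ∃ w, d.strings.Adj v w

/-- An edge, a boundary end and the status of an outer node would fill three slots. -/
theorem _root_.DiluteGhost.not_adj_of_outer_mem_glueEnds (hx : x.IsDiagram) (hy : y.IsDiagram)
    {a : Node n} {q : Vertex n} (ha : Vertex.outer a ∈ glueEnds x y) :
    ¬ (glue x y).Adj (Vertex.outer a) q := by
  classical
  intro hq
  have h := card_neighborFinset_glue_add_le hx hy (Vertex.outer a)
  have h1 : 0 < ((glue x y).neighborFinset (Vertex.outer a)).card :=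
    Finset.card_pos.2 ⟨q, by simpa using hq⟩
  have h2 := List.count_pos_iff.2 ha
  have h3 : 0 < (Finset.univ.filter fun v => Vertex.outer v = Vertex.outer a).card :=
    Finset.card_pos.2 ⟨a, by simp⟩
  omega

theorem mem_loops {p : Vertex n} : (glue x y).connectedComponentMk p ∈ loops x y ↔
    ∀ q, (glue x y).Reachable p q →
      ∃ i, q = Vertex.middle i ∧ x.Linked (Node.right i) ∧ y.Linked (Node.left i) := by
  simp only [loops, Set.mem_ofPred_eq, SimpleGraph.ConnectedComponent.mem_supp_iff,
    SimpleGraph.ConnectedComponent.eq]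
  exact ⟨fun h q hq => h q hq.symm, fun h q hq => h q hq.symm⟩

/-- The components of a graph all of whose vertices satisfy `good`. -/
def componentsOf (G : SimpleGraph V) (good : V → Prop) : Set G.ConnectedComponent :=
  {C | ∀ w, G.connectedComponentMk w = C → good w}

theorem mem_componentsOf {good : V → Prop} {p : V} :
    G.connectedComponentMk p ∈ componentsOf G good ↔ ∀ q, G.Reachable p q → good q := by
  simp only [componentsOf, Set.mem_ofPred_eq, SimpleGraph.ConnectedComponent.eq]
  exact ⟨fun h q hq => h q hq.symm, fun h q hq => h q hq.symm⟩

/-- A loop of `G` that meets no vertex from `k` is an inner loop; any other one becomes a loop of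
the outer product. The predicate `good` marks vertices that loops of `G` can pass, and `c` the part
of this condition at the outer nodes of the inner product that concerns the further drawing. -/
theorem ncard_loops_add_ncard_loops (h : Nested G x y X Y j k e B) (hx : x.IsDiagram)
    (hy : y.IsDiagram) (hc : Compatible x y) (good : V → Prop) (c : Node n → Prop)
    (hj : ∀ i, good (j (Vertex.middle i)) ↔ x.Linked (Node.right i) ∧ y.Linked (Node.left i))
    (hk : ∀ u, good (k u) ↔ ∃ a, u = e a ∧ (∃ q, (glue x y).Adj (Vertex.outer a) q) ∧ c a)
    (hH : ∀ u, (∃ i, u = Vertex.middle i ∧ X.Linked (Node.right i) ∧ Y.Linked (Node.left i)) ↔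
      ∃ a, u = e a ∧ (concat x y).Linked a ∧ c a) :
    (loops x y).ncard + (loops X Y).ncard = (componentsOf G good).ncard := by
  let F : (glue x y).ConnectedComponent → G.ConnectedComponent :=
    SimpleGraph.ConnectedComponent.lift (fun p => G.connectedComponentMk (j p)) fun _ _ w _ =>
      SimpleGraph.ConnectedComponent.sound (h.reachable_inner ⟨w⟩)
  let F' : (glue X Y).ConnectedComponent → G.ConnectedComponent :=
    SimpleGraph.ConnectedComponent.lift (fun p => G.connectedComponentMk (k p)) fun _ _ w _ =>
      SimpleGraph.ConnectedComponent.sound (h.reachable_of_reachable_outer ⟨w⟩)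
  have hclosed : ∀ p, (glue x y).connectedComponentMk p ∈ loops x y →
      ∀ v, ¬ (glue x y).Reachable (Vertex.outer v) p := by
    intro p hp v hv
    obtain ⟨i, hi, -⟩ := mem_loops.1 hp _ hv.symm
    rcases v with v | v <;> simp at hi
  have hF : Set.InjOn F (loops x y) := by
    intro C hC C' _ hCC
    induction C using SimpleGraph.ConnectedComponent.ind with | _ p
    induction C' using SimpleGraph.ConnectedComponent.ind with | _ p'
    obtain ⟨q, hq, hpq⟩ := h.reachable_from_closed (hclosed p hC)
      (SimpleGraph.ConnectedComponent.exact hCC)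
    rw [h.j_injective hq]
    exact SimpleGraph.ConnectedComponent.sound hpq
  have hF' : Function.Injective F' := by
    intro C C' hCC
    induction C using SimpleGraph.ConnectedComponent.ind with | _ p
    induction C' using SimpleGraph.ConnectedComponent.ind with | _ p'
    exact SimpleGraph.ConnectedComponent.sound
      (h.reachable_outer_iff.1 (SimpleGraph.ConnectedComponent.exact hCC))
  have hdisj : Disjoint (F '' loops x y) (F' '' loops X Y) := by
    rw [Set.disjoint_left]
    rintro _ ⟨C, hC, rfl⟩ ⟨C', -, hCC⟩
    induction C using SimpleGraph.ConnectedComponent.ind with | _ p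
    induction C' using SimpleGraph.ConnectedComponent.ind with | _ p'
    exact h.not_reachable_closed_outer (hclosed p hC)
      (SimpleGraph.ConnectedComponent.exact hCC).symm
  have houter : ∀ u, (glue X Y).connectedComponentMk u ∈ loops X Y ↔
      ∀ w, G.Reachable (k u) w → good w := by
    intro u
    rw [mem_loops]
    simp only [hH]
    constructor
    · intro hu
      have hgk : ∀ v, G.Reachable (k u) (k v) → good (k v) := by
        intro v hv
        obtain ⟨a, rfl, ⟨b, hab⟩, hca⟩ := hu v (h.reachable_outer_iff.1 hv)
        exact (hk _).2 ⟨a, rfl,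
          exists_adj_of_reachable_of_ne hab.2 (Vertex.outer_injective.ne hab.1), hca⟩
      intro w hw
      rcases h.range w with ⟨p, rfl⟩ | ⟨v, rfl⟩
      · obtain ⟨a, hua, hap⟩ := (h.reachable_from_outer hw).2 p rfl
        by_cases hp : ∃ a, p = Vertex.outer a
        · obtain ⟨a, rfl⟩ := hp
          rw [← h.k_e] at hw ⊢
          exact hgk _ hw
        · have hadj := exists_adj_of_reachable_of_ne hap.symm fun h' => hp ⟨a, h'⟩
          -- A boundary end here would join `a` to a boundary in `concat x y`, where `a` is joined
          -- to another node.
          have hend : p ∉ glueEnds x y := by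
            intro hpe
            obtain ⟨a', ha', ⟨b, hab⟩, -⟩ := hu _ hua
            obtain rfl : a = a' := by
              have := congrArg k ha'
              rw [h.k_e, h.k_e] at this
              exact Vertex.outer_injective (h.j_injective this)
            have hae : a ∈ (concat x y).ends := by
              rw [ends_concat, List.mem_filterMap]
              exact ⟨p, hpe, (relabel_eq_some_iff hx hy hpe).2 hap⟩
            obtain ⟨s, hs⟩ := Drawing.mem_ends.1 hae
            exact (isDiagram_concat hx hy).not_adj s a b hs hab
          rcases p with i | i | i
          · exact absurd ⟨Node.left i, rfl⟩ hp
          · exact (hj i).2 (exists_adj_of_middle hc hadj hend)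
          · exact absurd ⟨Node.right i, rfl⟩ hp
      · exact hgk v hw
    · intro hu v hv
      obtain ⟨a, rfl, haq, hca⟩ := (hk v).1 (hu _ (h.reachable_of_reachable_outer hv))
      refine ⟨a, rfl, ?_, hca⟩
      -- The inner string at `a` survives in `concat x y`. It cannot run to a boundary, since its
      -- last vertex would not be good.
      have hocc := (occupied_concat_iff hx hy hc a).2 (Or.inl haq)
      refine (Drawing.occupied_iff.1 hocc).resolve_right fun hae => ?_
      rw [ends_concat, List.mem_filterMap] at hae
      obtain ⟨p, hpe, hpa⟩ := hae
      have hgp : good (j p) := by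
        refine hu _ ((h.reachable_of_reachable_outer hv).trans ?_)
        rw [h.k_e]
        exact h.reachable_inner (reachable_of_relabel_eq_some hpa)
      have hnot : ∀ a, Vertex.outer a ∈ glueEnds x y → ¬ good (j (Vertex.outer a)) := by
        intro a ha hg
        rw [← h.k_e, hk] at hg
        obtain ⟨a', ha', ⟨q, hq⟩, -⟩ := hg
        obtain rfl : a = a' := by
          have := congrArg k ha'
          rw [h.k_e, h.k_e] at this
          exact Vertex.outer_injective (h.j_injective this)
        exact not_adj_of_outer_mem_glueEnds hx hy ha hq
      rcases p with i | i | i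
      · exact hnot (Node.left i) hpe hgp
      · obtain ⟨⟨v, hv⟩, ⟨w, hw⟩⟩ := (hj i).1 hgp
        rcases mem_glueEnds.1 hpe with ⟨u | u, hu, hu'⟩ | ⟨u | u, hu, hu'⟩ <;>
          simp only [Vertex.ofFirst_left, Vertex.ofFirst_right, Vertex.ofSecond_left,
            Vertex.ofSecond_right, Vertex.middle.injEq, reduceCtorEq] at hu' <;> subst hu' <;>
          obtain ⟨s, hs⟩ := Drawing.mem_ends.1 hu
        · exact hx.not_adj s _ _ hs hv
        · exact hy.not_adj s _ _ hs hw
      · exact hnot (Node.right i) hpe hgp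
  have hunion : componentsOf G good = F '' loops x y ∪ F' '' loops X Y := by
    ext C
    induction C using SimpleGraph.ConnectedComponent.ind with | _ w
    rw [mem_componentsOf]
    constructor
    · intro hw
      by_cases hu : ∃ u, G.Reachable w (k u)
      · obtain ⟨u, hu⟩ := hu
        refine Or.inr ⟨(glue X Y).connectedComponentMk u, ?_,
          SimpleGraph.ConnectedComponent.sound hu.symm⟩
        exact (houter u).2 fun q hq => hw q (hu.trans hq)
      · rcases h.range w with ⟨p, rfl⟩ | ⟨u, rfl⟩
        · refine Or.inl ⟨(glue x y).connectedComponentMk p, ?_, rfl⟩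
          rw [mem_loops]
          intro q hq
          have hq' := h.reachable_inner hq
          rcases q with i | i | i
          · exact absurd ⟨e (Node.left i), by rw [h.k_e]; exact hq'⟩ hu
          · exact ⟨i, rfl, (hj i).1 (hw _ hq')⟩
          · exact absurd ⟨e (Node.right i), by rw [h.k_e]; exact hq'⟩ hu
        · exact absurd ⟨u, SimpleGraph.Reachable.refl _⟩ hu
    · rintro (⟨C, hC, hCw⟩ | ⟨C, hC, hCw⟩)
      · induction C using SimpleGraph.ConnectedComponent.ind with | _ p
        intro w' hw'
        obtain ⟨q, rfl, hq⟩ := h.reachable_from_closed (hclosed p hC)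
          ((SimpleGraph.ConnectedComponent.exact hCw).trans hw')
        obtain ⟨i, rfl, hi⟩ := mem_loops.1 hC q hq
        exact (hj i).2 hi
      · induction C using SimpleGraph.ConnectedComponent.ind with | _ u
        exact fun w' hw' => (houter u).1 hC w'
          ((SimpleGraph.ConnectedComponent.exact hCw).trans hw')
  have hfin : ∀ a b : Drawing n, Finite (glue a b).ConnectedComponent :=
    fun a b => Quot.finite _
  have := hfin x y
  have := hfin X Y
  rw [hunion, Set.ncard_union_eq hdisj ((Set.toFinite _).image _) ((Set.toFinite _).image _),
    hF.ncard_image, Set.ncard_image_of_injective _ hF']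

end Nested

end

/-! ### Comparison of the two bracketings -/

section

variable {n : ℕ}

/-- The marks on both boundaries, from the marks on each. -/
def tagSides {α : Type} (M : Side → List (Bool × α)) : List (Side × Bool × α) :=
  (M Side.top).map (Prod.mk Side.top) ++ (M Side.bottom).map (Prod.mk Side.bottom)

theorem tagSides_filterMap {α γ : Type} (M : Side → List (Bool × α)) (φ : α → Option γ) :
    tagSides (fun s => (M s).filterMap fun m => (φ m.2).map (Prod.mk m.1)) =
      (tagSides M).filterMap fun m => (φ m.2.2).map fun a => (m.1, m.2.1, a) := by
  simp [tagSides, List.map_filterMap, List.filterMap_map, Function.comp_def]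

theorem tagSides_map {α γ : Type} (M : Side → List (Bool × α)) (φ : α → γ) :
    tagSides (fun s => (M s).map fun m => (m.1, φ m.2)) =
      (tagSides M).map fun m => (m.1, m.2.1, φ m.2.2) := by
  simp [tagSides, Function.comp_def]

namespace Nested

variable {V : Type} {G : SimpleGraph V} {x y X Y : Drawing n} {j k : Vertex n → V}
  {e : Node n → Vertex n} {B : SimpleGraph (Vertex n)} {W : Side → List (Option V)}
  {M : Side → List (Bool × (Vertex n ⊕ Vertex n))}

/-- The right-hand side involves only `G`, `good` and `W`, which can be chosen equal for both
bracketings. -/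
theorem weight_mul_weight (h : Nested G x y X Y j k e B) (hx : x.IsDiagram)
    (hy : y.IsDiagram) (hc : Compatible x y) {good : V → Prop} {c : Node n → Prop}
    (hj : ∀ i, good (j (Vertex.middle i)) ↔ x.Linked (Node.right i) ∧ y.Linked (Node.left i))
    (hk : ∀ u, good (k u) ↔ ∃ a, u = e a ∧ (∃ q, (glue x y).Adj (Vertex.outer a) q) ∧ c a)
    (hH : ∀ u, (∃ i, u = Vertex.middle i ∧ X.Linked (Node.right i) ∧ Y.Linked (Node.left i)) ↔
      ∃ a, u = e a ∧ (concat x y).Linked a ∧ c a)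
    (hI : ∀ s, marks true (glueWord x y s) =
      (M s).filterMap fun m => m.2.getLeft?.map (Prod.mk m.1))
    (hR : ∀ s, marks true (glueWord X Y s) =
      (M s).filterMap fun m => (residual x y e m.2).map (Prod.mk m.1))
    (hW : ∀ s, marks true (W s) = (M s).map fun m => (m.1, Sum.elim j k m.2))
    {R : Type*} [CommRing R] (P : Params R) :
    weight P x y * weight P X Y = P.β ^ (componentsOf G good).ncard *
      arcWeight P G.Reachable (taggedMarks W) := by
  have eI : taggedMarks (glueWord x y) = (tagSides M).filterMap fun m =>
      m.2.2.getLeft?.map fun a => (m.1, m.2.1, a) := by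
    rw [← tagSides_filterMap, ← funext hI]
    rfl
  have eR : taggedMarks (glueWord X Y) = (tagSides M).filterMap fun m =>
      (residual x y e m.2.2).map fun a => (m.1, m.2.1, a) := by
    rw [← tagSides_filterMap, ← funext hR]
    rfl
  have eW : taggedMarks W = (tagSides M).map fun m => (m.1, m.2.1, Sum.elim j k m.2.2) := by
    rw [← tagSides_map, ← funext hW]
    rfl
  rw [← h.ncard_loops_add_ncard_loops hx hy hc good c hj hk hH, weight_eq, weight_eq, eW,
    h.arcWeight_eq P, ← eI, ← eR, pow_add]
  · ring
  · have := pairwise_glueEnds hx hy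
    rw [← map_taggedMarks_glueWord, eI, List.map_filterMap] at this
    simpa [Option.map_map, Function.comp_def] using this

theorem marks_concat_eq (h : Nested G x y X Y j k e B) (hX : X.IsDiagram) (hY : Y.IsDiagram)
    (s : Side)
    (hR : marks true (glueWord X Y s) =
      (M s).filterMap fun m => (residual x y e m.2).map (Prod.mk m.1))
    (hW : marks true (W s) = (M s).map fun m => (m.1, Sum.elim j k m.2)) :
    marks true ((concat X Y).word s) = (marks true (W s)).filterMap fun m =>
      (outerEnd G (fun v => k (Vertex.outer v)) m.2).map (Prod.mk m.1) := by
  rw [marks_concat, hR, hW, List.filterMap_filterMap, List.filterMap_map]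
  refine List.filterMap_congr fun m hm => ?_
  have hl : ∀ u, residual x y e m.2 = some u → u ∈ glueEnds X Y := by
    intro u hu
    have : (m.1, u) ∈ marks true (glueWord X Y s) := by
      rw [hR, List.mem_filterMap]
      exact ⟨m, hm, by rw [hu]; rfl⟩
    refine mem_glueEnds_of_mem_glueWord (s := s) ?_
    rw [← List.reduceOption_mem_iff, ← map_snd_marks true]
    exact List.mem_map_of_mem this
  have := h.relabel_residual hX hY hl
  rw [Function.comp_apply, ← this]
  rcases residual x y e m.2 with _ | u <;> rfl

theorem strings_concat_adj (h : Nested G x y X Y j k e B) (v w : Node n) :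
    (concat X Y).strings.Adj v w ↔
      v ≠ w ∧ G.Reachable (k (Vertex.outer v)) (k (Vertex.outer w)) := by
  rw [h.reachable_outer_iff]
  rfl

end Nested

/-! ### Three diagrams -/

/-- The `4n` nodes of three rectangles placed side by side, with adjacent nodes identified. -/
inductive TripleVertex (n : ℕ) : Type
  | left (i : Fin n)
  | middle₁ (i : Fin n)
  | middle₂ (i : Fin n)
  | right (i : Fin n)

namespace TripleVertex

/-- The vertices of the first two rectangles. -/
def ofFirstTwo : Vertex n → TripleVertex n
  | Vertex.left i => left i
  | Vertex.middle i => middle₁ i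
  | Vertex.right i => middle₂ i

/-- The vertices of the last two rectangles. -/
def ofLastTwo : Vertex n → TripleVertex n
  | Vertex.left i => middle₁ i
  | Vertex.middle i => middle₂ i
  | Vertex.right i => right i

/-- The vertices that remain when the first two rectangles are concatenated. -/
def skipFirst : Vertex n → TripleVertex n
  | Vertex.left i => left i
  | Vertex.middle i => middle₂ i
  | Vertex.right i => right i

/-- The vertices that remain when the last two rectangles are concatenated. -/
def skipSecond : Vertex n → TripleVertex n
  | Vertex.left i => left i
  | Vertex.middle i => middle₁ i
  | Vertex.right i => right i

end TripleVertex

open TripleVertex Vertex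

variable {x y z : Drawing n}

/-- The graph formed by the strings joining two nodes in the concatenation of three drawings. -/
def tripleGlue (x y z : Drawing n) : SimpleGraph (TripleVertex n) where
  Adj p q := (∃ u v, x.strings.Adj u v ∧ ofFirstTwo (ofFirst u) = p ∧ ofFirstTwo (ofFirst v) = q) ∨
    (∃ u v, y.strings.Adj u v ∧ ofFirstTwo (ofSecond u) = p ∧ ofFirstTwo (ofSecond v) = q) ∨
    ∃ u v, z.strings.Adj u v ∧ ofLastTwo (ofSecond u) = p ∧ ofLastTwo (ofSecond v) = q
  symm := ⟨by
    rintro p q (⟨u, v, h, h1, h2⟩ | ⟨u, v, h, h1, h2⟩ | ⟨u, v, h, h1, h2⟩)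
    · exact Or.inl ⟨v, u, h.symm, h2, h1⟩
    · exact Or.inr (Or.inl ⟨v, u, h.symm, h2, h1⟩)
    · exact Or.inr (Or.inr ⟨v, u, h.symm, h2, h1⟩)⟩
  loopless := ⟨by
    rintro p (⟨u, v, h, rfl, h2⟩ | ⟨u, v, h, rfl, h2⟩ | ⟨u, v, h, rfl, h2⟩) <;>
    · refine h.ne ?_
      rcases u with i | i <;> rcases v with j | j <;> simp_all [ofFirstTwo, ofLastTwo]⟩

/-- The ghosts and string endpoints on a boundary of the concatenation of three drawings. -/
def tripleWord (x y z : Drawing n) (s : Side) : List (Option (TripleVertex n)) :=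
  (x.word s).map (Option.map fun u => ofFirstTwo (ofFirst u)) ++
    (y.word s).map (Option.map fun u => ofFirstTwo (ofSecond u)) ++
    (z.word s).map (Option.map fun u => ofLastTwo (ofSecond u))

/-- The vertices at which loops of the concatenation of three diagrams pass. -/
def TripleVertex.OnLoop (x y z : Drawing n) : TripleVertex n → Prop
  | middle₁ i => x.Linked (Node.right i) ∧ y.Linked (Node.left i)
  | middle₂ i => y.Linked (Node.right i) ∧ z.Linked (Node.left i)
  | _ => False

theorem nested_left (x y z : Drawing n) :
    Nested (tripleGlue x y z) x y (concat x y) z ofFirstTwo skipFirst ofFirst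
      (z.strings.map ofSecond) where
  j_injective := by rintro (i | i | i) (j | j | j) h <;> simp_all [ofFirstTwo]
  k_injective := by rintro (i | i | i) (j | j | j) h <;> simp_all [skipFirst]
  k_e := by rintro (i | i) <;> rfl
  exists_of_eq := by
    rintro (i | i | i) (j | j | j) h <;>
      simp only [skipFirst, ofFirstTwo, TripleVertex.left.injEq, TripleVertex.middle₂.injEq,
        reduceCtorEq] at h <;> subst h
    · exact ⟨Node.left i, rfl, rfl⟩
    · exact ⟨Node.right i, rfl, rfl⟩
  range := by
    rintro (i | i | i | i)
    · exact Or.inl ⟨Vertex.left i, rfl⟩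
    · exact Or.inl ⟨Vertex.middle i, rfl⟩
    · exact Or.inl ⟨Vertex.right i, rfl⟩
    · exact Or.inr ⟨Vertex.right i, rfl⟩
  adj_iff p q := by
    have e : ∀ u : Node n, skipFirst (ofSecond u) = ofLastTwo (ofSecond u) := by
      rintro (i | i) <;> rfl
    simp only [tripleGlue, glue_adj, SimpleGraph.map_adj]
    grind
  adj_iff' u v := by
    rw [glue, SimpleGraph.sup_adj, SimpleGraph.map_adj]

theorem nested_right (x y z : Drawing n) :
    Nested (tripleGlue x y z) y z x (concat y z) ofLastTwo skipSecond ofSecond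
      (x.strings.map ofFirst) where
  j_injective := by rintro (i | i | i) (j | j | j) h <;> simp_all [ofLastTwo]
  k_injective := by rintro (i | i | i) (j | j | j) h <;> simp_all [skipSecond]
  k_e := by rintro (i | i) <;> rfl
  exists_of_eq := by
    rintro (i | i | i) (j | j | j) h <;>
      simp only [skipSecond, ofLastTwo, TripleVertex.right.injEq, TripleVertex.middle₁.injEq,
        reduceCtorEq] at h <;> subst h
    · exact ⟨Node.left i, rfl, rfl⟩
    · exact ⟨Node.right i, rfl, rfl⟩
  range := by
    rintro (i | i | i | i)
    · exact Or.inr ⟨Vertex.left i, rfl⟩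
    · exact Or.inl ⟨Vertex.left i, rfl⟩
    · exact Or.inl ⟨Vertex.middle i, rfl⟩
    · exact Or.inl ⟨Vertex.right i, rfl⟩
  adj_iff p q := by
    have e : ∀ u : Node n, skipSecond (ofFirst u) = ofFirstTwo (ofFirst u) := by
      rintro (i | i) <;> rfl
    have e' : ∀ u : Node n, ofLastTwo (ofFirst u) = ofFirstTwo (ofSecond u) := by
      rintro (i | i) <;> rfl
    simp only [tripleGlue, glue_adj, SimpleGraph.map_adj]
    grind
  adj_iff' u v := by
    rw [glue, SimpleGraph.sup_adj, SimpleGraph.map_adj, SimpleGraph.map_adj, or_comm]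

theorem exists_glue_adj_left {i : Fin n} :
    (∃ q, (glue x y).Adj (Vertex.left i) q) ↔ x.Linked (Node.left i) := by
  constructor
  · rintro ⟨q, hq⟩
    rcases glue_adj.1 hq with ⟨u | u, v, huv, h, rfl⟩ | ⟨u | u, v, huv, h, rfl⟩ <;> simp at h
    exact h ▸ ⟨v, huv⟩
  · rintro ⟨w, h⟩
    exact ⟨_, glue_adj_first h⟩

theorem exists_glue_adj_right {i : Fin n} :
    (∃ q, (glue x y).Adj (Vertex.right i) q) ↔ y.Linked (Node.right i) := by
  constructor
  · rintro ⟨q, hq⟩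
    rcases glue_adj.1 hq with ⟨u | u, v, huv, h, rfl⟩ | ⟨u | u, v, huv, h, rfl⟩ <;> simp at h
    exact h ▸ ⟨v, huv⟩
  · rintro ⟨w, h⟩
    exact ⟨_, glue_adj_second h⟩

/-- The marks of the concatenation of three diagrams, with the third one kept apart. -/
def leftMarks (x y z : Drawing n) (s : Side) : List (Bool × (Vertex n ⊕ Vertex n)) :=
  (marks true (glueWord x y s)).map (fun m => (m.1, Sum.inl m.2)) ++
    (marks true (z.word s)).map fun m => (m.1, Sum.inr (ofSecond m.2))

/-- The marks of the concatenation of three diagrams, with the first one kept apart. -/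
def rightMarks (x y z : Drawing n) (s : Side) : List (Bool × (Vertex n ⊕ Vertex n)) :=
  (marks true (x.word s)).map (fun m => (m.1, Sum.inr (ofFirst m.2))) ++
    (marks true (glueWord y z s)).map fun m => (m.1, Sum.inl m.2)

theorem marks_glueWord (hx : x.IsDiagram) (s : Side) :
    marks true (glueWord x y s) = (marks true (x.word s)).map (fun m => (m.1, ofFirst m.2)) ++
      (marks true (y.word s)).map fun m => (m.1, ofSecond m.2) := by
  rw [glueWord, marks_append _ _ _ (by simpa using hx.even s), marks_map_map, marks_map_map]

theorem marks_tripleWord (hx : x.IsDiagram) (hy : y.IsDiagram) (s : Side) :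
    marks true (tripleWord x y z s) =
      (marks true (x.word s)).map (fun m => (m.1, ofFirstTwo (ofFirst m.2))) ++
        (marks true (y.word s)).map (fun m => (m.1, ofFirstTwo (ofSecond m.2))) ++
          (marks true (z.word s)).map fun m => (m.1, ofLastTwo (ofSecond m.2)) := by
  rw [tripleWord, marks_append _ _ _ (by simpa using (hx.even s).add (hy.even s)),
    marks_append _ _ _ (by simpa using hx.even s), marks_map_map, marks_map_map, marks_map_map]

theorem leftMarks_inner (s : Side) : marks true (glueWord x y s) =
    (leftMarks x y z s).filterMap fun m => m.2.getLeft?.map (Prod.mk m.1) := by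
  simp [leftMarks, List.filterMap_map, Function.comp_def]

theorem rightMarks_inner (s : Side) : marks true (glueWord y z s) =
    (rightMarks x y z s).filterMap fun m => m.2.getLeft?.map (Prod.mk m.1) := by
  simp [rightMarks, List.filterMap_map, Function.comp_def]

theorem leftMarks_residual (hx : x.IsDiagram) (hy : y.IsDiagram) (s : Side) :
    marks true (glueWord (concat x y) z s) = (leftMarks x y z s).filterMap fun m =>
      (Nested.residual x y ofFirst m.2).map (Prod.mk m.1) := by
  rw [marks_glueWord (isDiagram_concat hx hy), marks_concat]
  simp [leftMarks, List.filterMap_map, List.map_filterMap, Function.comp_def, Nested.residual]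

theorem rightMarks_residual (hx : x.IsDiagram) (s : Side) :
    marks true (glueWord x (concat y z) s) = (rightMarks x y z s).filterMap fun m =>
      (Nested.residual y z ofSecond m.2).map (Prod.mk m.1) := by
  rw [marks_glueWord hx, marks_concat]
  simp [rightMarks, List.filterMap_map, List.map_filterMap, Function.comp_def, Nested.residual]

theorem leftMarks_triple (hx : x.IsDiagram) (hy : y.IsDiagram) (s : Side) :
    marks true (tripleWord x y z s) = (leftMarks x y z s).map fun m =>
      (m.1, Sum.elim ofFirstTwo skipFirst m.2) := by
  have e : ∀ u : Node n, skipFirst (ofSecond u) = ofLastTwo (ofSecond u) := by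
    rintro (i | i) <;> rfl
  rw [marks_tripleWord hx hy, leftMarks, marks_glueWord hx]
  simp [e, Function.comp_def]

theorem rightMarks_triple (hx : x.IsDiagram) (hy : y.IsDiagram) (s : Side) :
    marks true (tripleWord x y z s) = (rightMarks x y z s).map fun m =>
      (m.1, Sum.elim ofLastTwo skipSecond m.2) := by
  have e : ∀ u : Node n, skipSecond (ofFirst u) = ofFirstTwo (ofFirst u) := by
    rintro (i | i) <;> rfl
  have e' : ∀ u : Node n, ofLastTwo (ofFirst u) = ofFirstTwo (ofSecond u) := by
    rintro (i | i) <;> rfl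
  rw [marks_tripleWord hx hy, rightMarks, marks_glueWord hy]
  simp [e, e', Function.comp_def]

theorem weight_mul_weight_concat_left (hx : x.IsDiagram) (hy : y.IsDiagram)
    (hc : Compatible x y) {R : Type*} [CommRing R] (P : Params R) :
    weight P x y * weight P (concat x y) z =
      P.β ^ (Nested.componentsOf (tripleGlue x y z) (OnLoop x y z)).ncard *
        arcWeight P (tripleGlue x y z).Reachable (taggedMarks (tripleWord x y z)) := by
  -- A loop can pass `concat x y` only at its right nodes, and there it has to continue in `z`.
  let c : Node n → Prop
    | Node.left _ => False
    | Node.right i => z.Linked (Node.left i)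
  refine (nested_left x y z).weight_mul_weight hx hy hc (c := c) (fun i => Iff.rfl) ?_ ?_
    leftMarks_inner (leftMarks_residual hx hy) (leftMarks_triple hx hy) P
  · intro u
    constructor
    · rcases u with i | i | i
      · exact False.elim
      · exact fun h => ⟨Node.right i, rfl, exists_glue_adj_right.2 h.1, h.2⟩
      · exact False.elim
    · rintro ⟨a | a, rfl, h, h'⟩
      · exact h'.elim
      · exact ⟨exists_glue_adj_right.1 h, h'⟩
  · intro u
    constructor
    · rintro ⟨i, rfl, h, h'⟩
      exact ⟨Node.right i, rfl, h, h'⟩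
    · rintro ⟨a | a, rfl, h, h'⟩
      · exact h'.elim
      · exact ⟨a, rfl, h, h'⟩

theorem weight_mul_weight_concat_right (hx : x.IsDiagram) (hy : y.IsDiagram) (hz : z.IsDiagram)
    (hc : Compatible y z) {R : Type*} [CommRing R] (P : Params R) :
    weight P y z * weight P x (concat y z) =
      P.β ^ (Nested.componentsOf (tripleGlue x y z) (OnLoop x y z)).ncard *
        arcWeight P (tripleGlue x y z).Reachable (taggedMarks (tripleWord x y z)) := by
  let c : Node n → Prop
    | Node.left i => x.Linked (Node.right i)
    | Node.right _ => False
  refine (nested_right x y z).weight_mul_weight hy hz hc (c := c) (fun i => Iff.rfl) ?_ ?_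
    rightMarks_inner (rightMarks_residual hx) (rightMarks_triple hx hy) P
  · intro u
    constructor
    · rcases u with i | i | i
      · exact False.elim
      · exact fun h => ⟨Node.left i, rfl, exists_glue_adj_left.2 h.2, h.1⟩
      · exact False.elim
    · rintro ⟨a | a, rfl, h, h'⟩
      · exact ⟨h', exists_glue_adj_left.1 h⟩
      · exact h'.elim
  · intro u
    constructor
    · rintro ⟨i, rfl, h, h'⟩
      exact ⟨Node.left i, rfl, h', h⟩
    · rintro ⟨a | a, rfl, h, h'⟩
      · exact ⟨a, rfl, h', h⟩
      · exact h'.elim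

/-- Strings and marks of both sides are read off from the same triple graph and word; the marks
suffice because both words are reduced and of even length. -/
theorem concat_assoc (hx : x.IsDiagram) (hy : y.IsDiagram) (hz : z.IsDiagram) :
    concat (concat x y) z = concat x (concat y z) := by
  have hxy := isDiagram_concat hx hy
  have hyz := isDiagram_concat hy hz
  have hl := isDiagram_concat hxy hz
  have hr := isDiagram_concat hx hyz
  -- Both bracketings place the outer nodes at the same vertices.
  have ho : (fun v : Node n => skipFirst (outer v)) = fun v => skipSecond (outer v) := by
    funext v
    rcases v with i | i <;> rfl
  refine Drawing.ext ?_ (funext fun s => ?_)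
  · ext v w
    rw [(nested_left x y z).strings_concat_adj, (nested_right x y z).strings_concat_adj,
      congrFun ho v, congrFun ho w]
  · refine eq_of_marks_eq (b := true) (hl.reduced s) (hr.reduced s)
      (by simp [hl.even s, hr.even s]) ?_
    rw [(nested_left x y z).marks_concat_eq hxy hz s (leftMarks_residual hx hy s)
        (leftMarks_triple hx hy s),
      (nested_right x y z).marks_concat_eq hx hyz s (rightMarks_residual hx s)
        (rightMarks_triple hx hy s), ho]

theorem compatible_concat_left (hx : x.IsDiagram) (hy : y.IsDiagram) (hc : Compatible x y) :
    Compatible (concat x y) z ↔ Compatible y z := by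
  refine forall_congr' fun i => ?_
  rw [occupied_concat_iff hx hy hc, outer_right, glueOccupied_right]

theorem compatible_concat_right (hy : y.IsDiagram) (hz : z.IsDiagram) (hc : Compatible y z) :
    Compatible x (concat y z) ↔ Compatible x y := by
  refine forall_congr' fun i => ?_
  rw [occupied_concat_iff hy hz hc, outer_left, glueOccupied_left]

/-! ### The algebra -/

section Algebra

variable {R : Type*} [CommRing R] (P : Params R)

/-- The concatenation of two diagrams, as a diagram. -/
def Diagram.concat (a b : Diagram n) : Diagram n :=
  ⟨DiluteGhost.concat a.toDrawing b.toDrawing, isDiagram_concat a.isDiagram b.isDiagram⟩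

theorem basis_mul_basis (a b : Diagram n) :
    DGh.basis P a * DGh.basis P b = mulDiagram P a b := by
  change mulBilin P _ _ = _
  rw [mulBilin, Module.Basis.constr_basis, Module.Basis.constr_basis]

theorem mulDiagram_of_compatible {a b : Diagram n} (h : Compatible a.toDrawing b.toDrawing) :
    mulDiagram P a b = weight P a.toDrawing b.toDrawing • DGh.basis P (a.concat b) := by
  rw [mulDiagram, if_pos h, dif_pos (isDiagram_concat a.isDiagram b.isDiagram)]
  rfl

theorem mulDiagram_of_not_compatible {a b : Diagram n}
    (h : ¬ Compatible a.toDrawing b.toDrawing) : mulDiagram P a b = 0 :=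
  if_neg h

/-- If either pair of neighbours is incompatible, both sides vanish, because an inner product that
is defined keeps the occupied outer nodes. -/
theorem basis_mul_assoc (a b c : Diagram n) :
    DGh.basis P a * DGh.basis P b * DGh.basis P c =
      DGh.basis P a * (DGh.basis P b * DGh.basis P c) := by
  rw [basis_mul_basis, basis_mul_basis]
  by_cases hab : Compatible a.toDrawing b.toDrawing
  · by_cases hbc : Compatible b.toDrawing c.toDrawing
    · have h1 : Compatible (a.concat b).toDrawing c.toDrawing :=
        (compatible_concat_left a.isDiagram b.isDiagram hab).2 hbc
      have h2 : Compatible a.toDrawing (b.concat c).toDrawing :=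
        (compatible_concat_right b.isDiagram c.isDiagram hbc).2 hab
      have h3 : (a.concat b).concat c = a.concat (b.concat c) :=
        Diagram.ext (congrArg Drawing.strings (concat_assoc a.isDiagram b.isDiagram c.isDiagram))
          (congrArg Drawing.word (concat_assoc a.isDiagram b.isDiagram c.isDiagram))
      have h4 := (weight_mul_weight_concat_left (z := c.toDrawing) a.isDiagram b.isDiagram hab
        P).trans (weight_mul_weight_concat_right a.isDiagram b.isDiagram c.isDiagram hbc P).symm
      rw [mulDiagram_of_compatible P hab, mulDiagram_of_compatible P hbc, smul_mul_assoc,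
        mul_smul_comm, basis_mul_basis, basis_mul_basis, mulDiagram_of_compatible P h1,
        mulDiagram_of_compatible P h2, smul_smul, smul_smul, h3]
      exact congrArg (· • _) h4
    · have h1 : ¬ Compatible (a.concat b).toDrawing c.toDrawing :=
        fun h => hbc ((compatible_concat_left a.isDiagram b.isDiagram hab).1 h)
      rw [mulDiagram_of_compatible P hab, mulDiagram_of_not_compatible P hbc, smul_mul_assoc,
        basis_mul_basis, mulDiagram_of_not_compatible P h1, smul_zero, mul_zero]
  · rw [mulDiagram_of_not_compatible P hab, zero_mul]
    by_cases hbc : Compatible b.toDrawing c.toDrawing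
    · have h2 : ¬ Compatible a.toDrawing (b.concat c).toDrawing :=
        fun h => hab ((compatible_concat_right b.isDiagram c.isDiagram hbc).1 h)
      rw [mulDiagram_of_compatible P hbc, mul_smul_comm, basis_mul_basis,
        mulDiagram_of_not_compatible P h2, smul_zero]
    · rw [mulDiagram_of_not_compatible P hbc, mul_zero]

theorem dgh_induction {p : DGh P n → Prop} (a : DGh P n) (zero : p 0)
    (add : ∀ a b, p a → p b → p (a + b)) (smul : ∀ (r : R) (a : DGh P n), p a → p (r • a))
    (basis : ∀ d, p (DGh.basis P d)) : p a := by
  have ha := (DGh.basis P).mem_span a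
  induction ha using Submodule.span_induction with
  | mem a h =>
    obtain ⟨d, rfl⟩ := h
    exact basis d
  | zero => exact zero
  | add a b _ _ ha hb => exact add a b ha hb
  | smul r a _ ha => exact smul r a ha

theorem dgh_mul_assoc (a b c : DGh P n) : a * b * c = a * (b * c) := by
  induction a using dgh_induction with
  | zero => simp
  | add a a' h h' => simp [add_mul, h, h']
  | smul r a h => simp [smul_mul_assoc, h]
  | basis a =>
    induction b using dgh_induction with
    | zero => simp
    | add b b' h h' => simp [mul_add, add_mul, h, h']
    | smul r b h => simp [smul_mul_assoc, mul_smul_comm, h]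
    | basis b =>
      induction c using dgh_induction with
      | zero => simp
      | add c c' h h' => simp [mul_add, h, h']
      | smul r c h => simp [mul_smul_comm, h]
      | basis c => exact basis_mul_assoc P a b c

end Algebra

end

end DiluteGhost

end

theorem theorem3 {R : Type*} [CommRing R] (P : DiluteGhost.Params R) (n : ℕ) :
    (∀ x y : DiluteGhost.Diagram n,
      (DiluteGhost.concat x.toDrawing y.toDrawing).IsDiagram) ∧
    (∀ a b c : DiluteGhost.DGh P n, a * b * c = a * (b * c)) :=
  ⟨fun x y => DiluteGhost.isDiagram_concat x.isDiagram y.isDiagram, DiluteGhost.dgh_mul_assoc P⟩
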